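/- Let $n\ge 1$ be an integer and $\alpha>0$. Let $D\subset\mathbb C$ be a domain (open and connected) containing $[0,+\infty)$, and let $f$ be analytic in $D$ with $f(z)=O(|z|^{\,n-1-\alpha})$ as $z\to\infty$ in $D$ (in particular $f(x)=O(x^{n-1-\alpha})$ as $x\to+\infty$). Then the Hadamard finite-part integral $$I^{(n)}[f]=\mathrm{f.p.}\!\int_0^\infty x^{-n}f(x)\,dx=\lim_{\epsilon\downarrow0}\left\{\int_\epsilon^\infty x^{-n}f(x)\,dx-\sum_{k=0}^{n-2}\frac{\epsilon^{k+1-n}}{k!\,(n-1-k)}f^{(k)}(0)+\frac{\log\epsilon}{(n-1)!}f^{(n-1)}(0)\right\}$$ exists (the sum is zero if $n=1$; the integrals over $(\epsilon,\infty)$ converge absolutely). Let $C$ be a piecewise $C^1$ path $\gamma:\mathbb R\to D\setminus[0,+\infty)$ with $|\gamma(t)|\to\infty$ as $t\to\pm\infty$ that encircles $[0,+\infty)$ in $D$ in the positive sense, meaning: for every $T$ there are $a\le -T$ and $b\ge T$ with $a<b$ and $|\gamma(a)|=|\gamma(b)|=:R$ such that the circular arc from $\gamma(b)=Re^{i\theta_b}$,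 $\theta_b\in(-2\pi,0)$, counterclockwise across the positive real axis to $\gamma(a)=Re^{i\theta_a}$, $\theta_a\in(0,2\pi)$, lies in $D$, and the closed curve formed by $\gamma|_{[a,b]}$ and this arc has winding number $1$ about every point of $[0,R)$ and $0$ about every point of $\mathbb C\setminus D$. If the improper contour integral below converges, then $$I^{(n)}[f]=\frac1{2\pi i}\oint_C z^{-n}f(z)\log(-z)\,dz ,$$ where $\log$ is the principal branch. The contour integral does converge whenever $\int_C(1+|z|)^{-1-\beta}\,|dz|<\infty$ for some $\beta<\alpha$. -/

import Mathlib

open Filter Topology Asymptotics MeasureTheory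

/-- The expression whose limit as `ε ↓ 0` is the Hadamard finite part of `∫₀^∞ x⁻ⁿ f(x) dx`:
`∫_ε^∞ x⁻ⁿ f(x) dx - ∑_{k=0}^{n-2} ε^{k+1-n} / (k! (n-1-k)) f⁽ᵏ⁾(0) + log ε / (n-1)! f⁽ⁿ⁻¹⁾(0)`.
The sum is empty for `n = 1`. -/
noncomputable def fpTruncated (n : ℕ) (f : ℂ → ℂ) (ε : ℝ) : ℂ :=
  (∫ x in Set.Ioi ε, (x : ℂ) ^ (-(n : ℤ)) * f (x : ℂ))
    - ∑ k ∈ Finset.range (n - 1),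
        (ε : ℂ) ^ ((k : ℤ) + 1 - (n : ℤ)) / ((k.factorial : ℂ) * ((n : ℂ) - 1 - (k : ℂ)))
          * iteratedDeriv k f 0
    + (Real.log ε : ℂ) / ((n - 1).factorial : ℂ) * iteratedDeriv (n - 1) f 0

/-- `I` is the Hadamard finite-part integral `f.p. ∫₀^∞ x⁻ⁿ f(x) dx`: the integrals over `(ε, ∞)`
converge absolutely and the regularized expression tends to `I` as `ε ↓ 0`. -/
def IsFinitePartIntegral (n : ℕ) (f : ℂ → ℂ) (I : ℂ) : Prop :=
  (∀ ε : ℝ, 0 < ε →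
      IntegrableOn (fun x : ℝ => (x : ℂ) ^ (-(n : ℤ)) * f (x : ℂ)) (Set.Ioi ε)) ∧
    Tendsto (fpTruncated n f) (𝓝[>] 0) (𝓝 I)

/-- A piecewise continuously differentiable path `ℝ → ℂ`: off a set of break points which is
finite in every compact interval it is `C¹` up to the end points of each piece. -/
def IsPiecewiseC1Path (γ : ℝ → ℂ) : Prop :=
  Continuous γ ∧ ∃ P : Set ℝ, (∀ a b : ℝ, (P ∩ Set.Icc a b).Finite) ∧
    ∀ a b : ℝ, a < b → Disjoint (Set.Ioo a b) P → ContDiffOn ℝ 1 γ (Set.Icc a b)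

/-- The (improper) contour integral `∫_γ g(z) dz` along the whole path `γ : ℝ → ℂ`
converges to `J`. -/
def HasContourIntegral (γ : ℝ → ℂ) (g : ℂ → ℂ) (J : ℂ) : Prop :=
  Tendsto (fun p : ℝ × ℝ => ∫ t in p.1..p.2, g (γ t) * deriv γ t) (atBot ×ˢ atTop) (𝓝 J)

/-- The argument in `(0, 2π)` of a point `z ∉ [0, ∞)`. -/
noncomputable def argAbove (z : ℂ) : ℝ := Complex.arg (-z) + Real.pi

/-- The argument in `(-2π, 0)` of a point `z ∉ [0, ∞)`. -/
noncomputable def argBelow (z : ℂ) : ℝ := Complex.arg (-z) - Real.pi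

/-- The winding number about `w` of the closed curve made of `γ` on `[a, b]` followed by the
arc of the circle with centre `0` and radius `‖γ a‖ = ‖γ b‖` which leads counterclockwise from
`γ b`, across the positive real axis, back to `γ a`. -/
noncomputable def closedUpIndex (γ : ℝ → ℂ) (a b : ℝ) (w : ℂ) : ℂ :=
  (2 * Real.pi * Complex.I)⁻¹ *
    ((∫ t in a..b, deriv γ t / (γ t - w)) +
      ∫ θ in argBelow (γ b)..argAbove (γ a),
        deriv (circleMap 0 ‖γ a‖) θ / (circleMap 0 ‖γ a‖ θ - w))

/-- The path `γ`, which comes from `∞` and returns to `∞` in `D \ [0, ∞)`, encircles the half line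
`[0, ∞)` within `D` in the positive sense: arbitrarily long pieces `γ|[a, b]`, when closed up
through an arc of a circle across the positive real axis, are closed curves in `D` that wind once
counterclockwise about each point of `[0, ∞)` inside that circle, and do not wind about any point
outside `D`. (A simple piecewise `C¹` path from `∞` to `∞` which has `[0, ∞)` on its left, and such
that the component of the complement of the path that contains `[0, ∞)` is contained in `D`, has
this property.) -/
structure EncirclesHalfLine (γ : ℝ → ℂ) (D : Set ℂ) : Prop where
  piecewiseC1 : IsPiecewiseC1Path γ
  mem_domain : ∀ t : ℝ, γ t ∈ D
  avoids : ∀ (t x : ℝ), 0 ≤ x → γ t ≠ (x : ℂ)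
  tendsto_infinity : Tendsto γ (cocompact ℝ) (cocompact ℂ)
  winds : ∀ T : ℝ, ∃ a b : ℝ, a ≤ -T ∧ T ≤ b ∧ a < b ∧ ‖γ a‖ = ‖γ b‖ ∧
    (∀ θ ∈ Set.Icc (argBelow (γ b)) (argAbove (γ a)), circleMap 0 ‖γ a‖ θ ∈ D) ∧
    (∀ x : ℝ, 0 ≤ x → x < ‖γ a‖ → closedUpIndex γ a b (x : ℂ) = 1) ∧
    (∀ w : ℂ, w ∉ D → closedUpIndex γ a b w = 0)

/-!
The integrand `z ^ (-n) f z` has a primitive on `(0, ∞)` whose expansion at `0` has no constant term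
(`fpPrimitive`). The finite part of its integral is the limit `I` of this primitive at `∞`: the
explicit terms in `fpTruncated` add the singular part of the primitive at `ε` to the integral over
`(ε, ∞)`, and the rest of the primitive vanishes with `ε` (`exists_isFinitePartIntegral`).

On the other side, close a long piece of the path by its arc of radius `R`, and start the resulting
closed curve at the point `R` of the cut, which is the only point of `[0, ∞)` on it (`IsKeyhole`).
The integral of `z ^ (-n) f z log (-z)` along this curve is exactly `2πi` times the value of the
primitive at `R` (`IsKeyhole.integral_eq_fpPrimitive`). For the polar part of the integrand at `0`
this is a computation with explicit primitives, in which `log (-z)` changes from `log R - πi` to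
`log R + πi` along the curve. For the holomorphic rest `g` consider
`Φ r = ∫ g(z) log (r - z) dz` (`logIntegral`). Since the curve winds once about the points of
`[0, R)`, Cauchy's formula gives `Φ' r = -2πi g(r)` for `0 < r < R`; for `r > R` the
integrand is holomorphic off a cut `[r, ∞)` about which the curve does not wind, and `Φ r = 0` by
Cauchy's theorem; and `Φ` is continuous across `R`, because logarithmic singularities are
integrable. So `Φ 0 = 2πi ∫₀ᴿ g`. As `R → ∞`, the contribution of the arc to the integral vanishes
by the growth condition.

The domain need not be simply connected, and the curves may intersect themselves, so the homology
version of Cauchy's theorem is needed. It is proved by Dixon's argument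
(`IsCurve.cauchy_formula`).
-/

/-! ### Curves and Cauchy's theorem in its homology version -/

lemma continuousOn_ite_le {E : Type*} [TopologicalSpace E] {a b d : ℝ} {u v : ℝ → E}
    (hab : a ≤ b) (hbd : b ≤ d) (hu : ContinuousOn u (Set.Icc a b))
    (hv : ContinuousOn v (Set.Icc b d)) (h : u b = v b) :
    ContinuousOn (fun t => if t ≤ b then u t else v t) (Set.Icc a d) := by
  rw [← Set.Icc_union_Icc_eq_Icc hab hbd]
  refine ContinuousOn.union_of_isClosed ?_ ?_ isClosed_Icc isClosed_Icc
  · exact hu.congr fun t ht => if_pos ht.2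
  · refine hv.congr fun t ht => ?_
    rcases ht.1.eq_or_lt with rfl | h'
    · simp [h]
    · simp [h']

/-- A path `c` on `[a, b]` with an integrable velocity `c'`: `c` is continuous and has derivative
`c'` off a countable set. The velocity is kept as a separate function, so that paths can be
concatenated without discussing derivatives at the junctions. -/
structure IsCurve (a b : ℝ) (c c' : ℝ → ℂ) : Prop where
  le : a ≤ b
  cont : ContinuousOn c (Set.Icc a b)
  hasDeriv : ∃ S : Set ℝ, S.Countable ∧ ∀ t ∈ Set.Ioo a b \ S, HasDerivAt c (c' t) t
  integrable : IntervalIntegrable c' volume a b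

namespace IsCurve

variable {a b : ℝ} {c c' : ℝ → ℂ}

lemma isCompact_image (h : IsCurve a b c c') : IsCompact (c '' Set.Icc a b) :=
  isCompact_Icc.image_of_continuousOn h.cont

lemma intervalIntegrable_mul (h : IsCurve a b c c') {g : ℝ → ℂ}
    (hg : ContinuousOn g (Set.Icc a b)) :
    IntervalIntegrable (fun t => g t * c' t) volume a b :=
  h.integrable.continuousOn_mul (by rwa [Set.uIcc_of_le h.le])

/-- The fundamental theorem of calculus along a curve. -/
lemma integral_eq_sub (h : IsCurve a b c c') {P p : ℝ → ℂ}
    (hP : ContinuousOn P (Set.Icc a b)) (hp : ContinuousOn p (Set.Icc a b))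
    (hd : ∀ t ∈ Set.Ioo a b, HasDerivAt c (c' t) t → HasDerivAt P (p t * c' t) t) :
    ∫ t in a..b, p t * c' t = P b - P a := by
  obtain ⟨S, hS, hcS⟩ := h.hasDeriv
  exact integral_eq_of_hasDerivAt_off_countable_of_le P _ h.le hS hP
    (fun t ht => hd t ht.1 (hcS t ht)) (h.intervalIntegrable_mul hp)

/-- Concatenation of curves. -/
lemma append {d : ℝ} {e e' : ℝ → ℂ} (h : IsCurve a b c c') (h2 : IsCurve b d e e')
    (hb : c b = e b) :
    IsCurve a d (fun t => if t ≤ b then c t else e t) (fun t => if t ≤ b then c' t else e' t) := by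
  refine ⟨h.le.trans h2.le, ?_, ?_, ?_⟩
  · exact continuousOn_ite_le h.le h2.le h.cont h2.cont hb
  · obtain ⟨S, hS, hcS⟩ := h.hasDeriv
    obtain ⟨T, hT, hcT⟩ := h2.hasDeriv
    refine ⟨insert b (S ∪ T), (hS.union hT).insert b, fun t ⟨ht, hn⟩ => ?_⟩
    simp only [Set.mem_insert_iff, Set.mem_union, not_or] at hn
    rcases lt_or_gt_of_ne hn.1 with hlt | hgt
    · rw [if_pos hlt.le]
      refine (hcS t ⟨⟨ht.1, hlt⟩, hn.2.1⟩).congr_of_eventuallyEq ?_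
      filter_upwards [Iio_mem_nhds hlt] with s hs
      exact if_pos (le_of_lt hs)
    · rw [if_neg hgt.not_ge]
      refine (hcT t ⟨⟨hgt, ht.2⟩, hn.2.2⟩).congr_of_eventuallyEq ?_
      filter_upwards [Ioi_mem_nhds hgt] with s hs
      exact if_neg (not_le_of_gt hs)
  · refine IntervalIntegrable.trans (b := b) ?_ ?_
    · refine h.integrable.congr fun t ht => ?_
      rw [Set.uIoc_of_le h.le] at ht
      simp [ht.2]
    · refine h2.integrable.congr fun t ht => ?_
      rw [Set.uIoc_of_le h2.le] at ht
      simp [not_le_of_gt ht.1]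

/-- Arcs of circles are curves. -/
lemma circleMap_add (R k : ℝ) (hab : a ≤ b) :
    IsCurve a b (fun t => circleMap 0 R (t + k)) (fun t => deriv (circleMap 0 R) (t + k)) := by
  refine ⟨hab, by fun_prop, ⟨∅, Set.countable_empty, fun t _ => ?_⟩, ?_⟩
  · rw [deriv_circleMap]
    exact (hasDerivAt_circleMap 0 R (t + k)).comp_add_const t k
  · simp only [deriv_circleMap]
    exact Continuous.intervalIntegrable (by fun_prop) _ _

lemma sub_ne_zero_of_notMem {z : ℂ} (hz : z ∉ c '' Set.Icc a b) :
    ∀ t ∈ Set.Icc a b, c t - z ≠ 0 :=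
  fun t ht h0 => hz ⟨t, ht, sub_eq_zero.1 h0⟩

lemma continuousOn_div_sub (h : IsCurve a b c c') {g : ℝ → ℂ}
    (hg : ContinuousOn g (Set.Icc a b)) {z : ℂ} (hz : z ∉ c '' Set.Icc a b) :
    ContinuousOn (fun t => g t / (c t - z)) (Set.Icc a b) :=
  hg.div (h.cont.sub continuousOn_const) (sub_ne_zero_of_notMem hz)

/-- The integral of `g(z) / (z - w)`, which is a Cauchy integral, is holomorphic in `w` off the
curve. -/
lemma differentiableAt_cauchy (h : IsCurve a b c c') {g : ℝ → ℂ}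
    (hg : ContinuousOn g (Set.Icc a b)) {z₀ : ℂ} (hz : z₀ ∉ c '' Set.Icc a b) :
    DifferentiableAt ℂ (fun z => ∫ t in a..b, g t / (c t - z) * c' t) z₀ := by
  obtain ⟨δ, hδ, hball⟩ := Metric.isOpen_iff.1 h.isCompact_image.isClosed.isOpen_compl z₀ hz
  have hdist : ∀ t ∈ Set.Icc a b, ∀ z ∈ Metric.ball z₀ (δ / 2), δ / 2 ≤ ‖c t - z‖ := by
    intro t ht z hz'
    by_contra hlt
    push Not at hlt
    refine hball (a := c t) ?_ ⟨t, ht, rfl⟩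
    rw [Metric.mem_ball, dist_eq_norm] at hz' ⊢
    calc ‖c t - z₀‖ = ‖(c t - z) + (z - z₀)‖ := by congr 1; ring
      _ ≤ ‖c t - z‖ + ‖z - z₀‖ := norm_add_le _ _
      _ < δ := by linarith
  have hne : ∀ t ∈ Set.Icc a b, ∀ z ∈ Metric.ball z₀ (δ / 2), c t - z ≠ 0 := by
    intro t ht z hz' h0
    have := hdist t ht z hz'
    rw [h0, norm_zero] at this
    linarith
  have hint : ∀ z ∈ Metric.ball z₀ (δ / 2),
      IntervalIntegrable (fun t => g t / (c t - z) * c' t) volume a b := fun z hz' =>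
    h.intervalIntegrable_mul (hg.div (h.cont.sub continuousOn_const) fun t ht => hne t ht z hz')
  have hz₀ : z₀ ∈ Metric.ball z₀ (δ / 2) := Metric.mem_ball_self (by linarith)
  have hgc : IntervalIntegrable (fun t => g t * c' t) volume a b := h.intervalIntegrable_mul hg
  have hIoc : Set.uIoc a b ⊆ Set.Icc a b := by
    rw [Set.uIoc_of_le h.le]; exact Set.Ioc_subset_Icc_self
  have key := intervalIntegral.hasDerivAt_integral_of_dominated_loc_of_deriv_le (μ := volume)
    (F := fun z t => g t / (c t - z) * c' t)
    (F' := fun z t => g t / (c t - z) ^ 2 * c' t) (x₀ := z₀) (a := a) (b := b)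
    (bound := fun t => ‖g t * c' t‖ / (δ / 2) ^ 2)
    (Metric.ball_mem_nhds z₀ (show 0 < δ / 2 by linarith))
    (by
      filter_upwards [Metric.ball_mem_nhds z₀ (show 0 < δ / 2 by linarith)] with z hz'
      exact (hint z hz').aestronglyMeasurable_restrict_uIoc)
    (hint z₀ hz₀)
    (h.intervalIntegrable_mul (g := fun t => g t / (c t - z₀) ^ 2)
      (hg.div ((h.cont.sub continuousOn_const).pow 2) fun t ht =>
        pow_ne_zero 2 (hne t ht z₀ hz₀))).aestronglyMeasurable_restrict_uIoc
    (by
      refine Eventually.of_forall fun t ht z hz' => ?_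
      have h1 := hdist t (hIoc ht) z hz'
      rw [div_mul_eq_mul_div, norm_div, norm_pow]
      gcongr)
    (hgc.norm.div_const _)
    (by
      refine Eventually.of_forall fun t ht z hz' => ?_
      have h1 := hne t (hIoc ht) z hz'
      have h2 : HasDerivAt (fun z => c t - z) (-1) z := by
        simpa using (hasDerivAt_id z).const_sub (c t)
      have h3 := (((hasDerivAt_const z (g t)).div h2 h1)).mul_const (c' t)
      refine h3.congr_deriv ?_
      simp)
  exact key.2.differentiableAt

end IsCurve

lemma dslope_comm (f : ℂ → ℂ) (z w : ℂ) : dslope f z w = dslope f w z := by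
  rcases eq_or_ne z w with rfl | h
  · rfl
  · rw [dslope_of_ne f h.symm, dslope_of_ne f h, slope_comm]

/-- Difference quotients `(f w - f z) / (w - z)` of a holomorphic function are bounded, for `z`
near a given point and `w` in a compact set, also near the diagonal. -/
lemma exists_norm_dslope_le {D : Set ℂ} (hD : IsOpen D) {f : ℂ → ℂ} (hf : DifferentiableOn ℂ f D)
    {K : Set ℂ} (hK : IsCompact K) (hKD : K ⊆ D) {z₀ : ℂ} (hz₀ : z₀ ∈ D) :
    ∃ r > 0, ∃ M : ℝ, Metric.ball z₀ r ⊆ D ∧ ∀ z ∈ Metric.ball z₀ r, ∀ w ∈ K,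
      ‖dslope f z w‖ ≤ M := by
  obtain ⟨ρ, hρ, hball⟩ := Metric.isOpen_iff.1 hD z₀ hz₀
  have hcb : Metric.closedBall z₀ (ρ / 2) ⊆ D :=
    (Metric.closedBall_subset_ball (by linarith)).trans hball
  obtain ⟨M, hM⟩ := ((hK.union (isCompact_closedBall z₀ (ρ / 2))).image_of_continuousOn
    (hf.continuousOn.mono (Set.union_subset hKD hcb))).isBounded.exists_norm_le
  obtain ⟨M', hM'⟩ := ((isCompact_closedBall z₀ (ρ / 2)).image_of_continuousOn
    ((hf.deriv hD).continuousOn.mono hcb)).isBounded.exists_norm_le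
  have hM : ∀ w ∈ K ∪ Metric.closedBall z₀ (ρ / 2), ‖f w‖ ≤ M := fun w hw => hM _ ⟨w, hw, rfl⟩
  have hM' : ∀ w ∈ Metric.closedBall z₀ (ρ / 2), ‖deriv f w‖ ≤ M' := fun w hw => hM' _ ⟨w, hw, rfl⟩
  have hsub : Metric.ball z₀ (ρ / 4) ⊆ Metric.closedBall z₀ (ρ / 2) :=
    (Metric.ball_subset_ball (by linarith)).trans Metric.ball_subset_closedBall
  refine ⟨ρ / 4, by linarith, max M' (2 * M / (ρ / 4)), hsub.trans hcb, fun z hz w hw => ?_⟩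
  rcases eq_or_ne w z with rfl | hne
  · rw [dslope_same]
    exact (hM' _ (hsub hz)).trans (le_max_left _ _)
  have hpos : 0 < ‖w - z‖ := norm_pos_iff.2 (sub_ne_zero.2 hne)
  rw [dslope_of_ne f hne, slope_def_field, norm_div]
  by_cases hwb : w ∈ Metric.closedBall z₀ (ρ / 2)
  · refine le_trans ?_ (le_max_left _ _)
    rw [div_le_iff₀ hpos]
    exact (convex_closedBall z₀ (ρ / 2)).norm_image_sub_le_of_norm_deriv_le
      (fun x hx => (hf x (hcb hx)).differentiableAt (hD.mem_nhds (hcb hx))) hM' (hsub hz) hwb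
  · refine le_trans ?_ (le_max_right _ _)
    have h1 : ρ / 4 ≤ ‖w - z‖ := by
      rw [Metric.mem_closedBall, not_le] at hwb
      rw [Metric.mem_ball] at hz
      have := dist_triangle w z z₀
      rw [← dist_eq_norm]
      linarith
    have h2 : ‖f w - f z‖ ≤ 2 * M := by
      have := norm_sub_le (f w) (f z)
      have := hM w (Or.inl hw)
      have := hM z (Or.inr (hsub hz))
      linarith
    have h0 : 0 ≤ 2 * M := (norm_nonneg _).trans h2
    gcongr

namespace IsCurve

variable {a b : ℝ} {c c' : ℝ → ℂ}

lemma continuousOn_dslope_comp (h : IsCurve a b c c') {D : Set ℂ} (hD : IsOpen D)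
    (hcD : ∀ t ∈ Set.Icc a b, c t ∈ D) {f : ℂ → ℂ} (hf : DifferentiableOn ℂ f D)
    {z : ℂ} (hz : z ∈ D) : ContinuousOn (fun t => dslope f z (c t)) (Set.Icc a b) :=
  ((Complex.differentiableOn_dslope (hD.mem_nhds hz)).2 hf).continuousOn.comp h.cont hcD

/-- The integral of the difference quotient `(f w - f z) / (w - z)` over `w` is holomorphic
in `z`. -/
lemma differentiableAt_integral_dslope (h : IsCurve a b c c') {D : Set ℂ} (hD : IsOpen D)
    (hcD : ∀ t ∈ Set.Icc a b, c t ∈ D) {f : ℂ → ℂ} (hf : DifferentiableOn ℂ f D)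
    {z₀ : ℂ} (hz₀ : z₀ ∈ D) :
    DifferentiableAt ℂ (fun z => ∫ t in a..b, dslope f z (c t) * c' t) z₀ := by
  obtain ⟨r, hr, M, hrD, hM⟩ := exists_norm_dslope_le hD hf h.isCompact_image
    (Set.image_subset_iff.2 hcD) hz₀
  have hIoc : Set.uIoc a b ⊆ Set.Icc a b := by
    rw [Set.uIoc_of_le h.le]; exact Set.Ioc_subset_Icc_self
  have hint : ∀ z ∈ D, IntervalIntegrable (fun t => dslope f z (c t) * c' t) volume a b :=
    fun z hz => h.intervalIntegrable_mul (h.continuousOn_dslope_comp hD hcD hf hz)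
  have hdiff : ∀ t ∈ Set.Icc a b, DifferentiableOn ℂ (fun z => dslope f z (c t)) D := by
    intro t ht
    refine ((Complex.differentiableOn_dslope (hD.mem_nhds (hcD t ht))).2 hf).congr fun z _ => ?_
    exact dslope_comm f _ _
  have hder : ∀ t ∈ Set.Icc a b, ∀ z ∈ D, HasDerivAt (fun z => dslope f z (c t) * c' t)
      (deriv (fun z => dslope f z (c t)) z * c' t) z := fun t ht z hz =>
    (((hdiff t ht) z hz).differentiableAt (hD.mem_nhds hz)).hasDerivAt.mul_const _
  have key := intervalIntegral.hasDerivAt_integral_of_dominated_loc_of_deriv_le (μ := volume)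
    (F := fun z t => dslope f z (c t) * c' t)
    (F' := fun z t => deriv (fun z => dslope f z (c t)) z * c' t) (x₀ := z₀) (a := a) (b := b)
    (bound := fun t => M / (r / 2) * ‖c' t‖)
    (Metric.ball_mem_nhds z₀ (show 0 < r / 2 by linarith))
    (by
      filter_upwards [hD.mem_nhds hz₀] with z hz
      exact (hint z hz).aestronglyMeasurable_restrict_uIoc)
    (hint z₀ hz₀)
    (by
      -- the derivative is measurable in `t`, being a limit of difference quotients
      have hlim : Tendsto (fun n : ℕ => z₀ + ((r / 2 / ((n : ℝ) + 1) : ℝ) : ℂ)) atTop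
          (𝓝[≠] z₀) := by
        refine tendsto_nhdsWithin_iff.2 ⟨?_, Eventually.of_forall fun n => ?_⟩
        · have h1 : Tendsto (fun n : ℕ => r / 2 / ((n : ℝ) + 1)) atTop (𝓝 0) :=
            tendsto_const_nhds.div_atTop
              (tendsto_atTop_add_const_right _ _ tendsto_natCast_atTop_atTop)
          simpa using ((Complex.continuous_ofReal.tendsto 0).comp h1).const_add z₀
        · have : (0 : ℝ) < r / 2 / ((n : ℝ) + 1) := by positivity
          simp only [Set.mem_compl_iff, Set.mem_singleton_iff, add_eq_left, Complex.ofReal_eq_zero]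
          exact this.ne'
      refine aestronglyMeasurable_of_tendsto_ae atTop
        (f := fun (n : ℕ) t => slope (fun z => dslope f z (c t) * c' t) z₀
          (z₀ + ((r / 2 / ((n : ℝ) + 1) : ℝ) : ℂ))) (fun n => ?_) ?_
      · have hmem : z₀ + ((r / 2 / ((n : ℝ) + 1) : ℝ) : ℂ) ∈ D := by
          refine hrD ?_
          have h0 : (0 : ℝ) < r / 2 / ((n : ℝ) + 1) := by positivity
          have h1 : r / 2 / ((n : ℝ) + 1) ≤ r / 2 :=
            div_le_self (by linarith) (by linarith [Nat.cast_nonneg (α := ℝ) n])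
          rw [Metric.mem_ball, dist_eq_norm, add_sub_cancel_left, Complex.norm_real,
            Real.norm_of_nonneg h0.le]
          linarith
        simp only [slope_def_field]
        exact (((hint _ hmem).aestronglyMeasurable_restrict_uIoc).sub
          ((hint _ hz₀).aestronglyMeasurable_restrict_uIoc)).mul_const _
      · refine (ae_restrict_iff' measurableSet_uIoc).2 (Eventually.of_forall fun t ht => ?_)
        exact (hasDerivAt_iff_tendsto_slope.1 (hder t (hIoc ht) z₀ hz₀)).comp hlim)
    (by
      refine Eventually.of_forall fun t ht z hz => ?_
      rw [norm_mul]
      gcongr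
      have hsub : Metric.closedBall z (r / 2) ⊆ Metric.ball z₀ r := fun w hw => by
        rw [Metric.mem_closedBall] at hw
        rw [Metric.mem_ball] at hz ⊢
        linarith [dist_triangle w z z₀]
      refine Complex.norm_deriv_le_of_forall_mem_sphere_norm_le (by linarith) ?_ fun w hw => ?_
      · refine DifferentiableOn.diffContOnCl (((hdiff t (hIoc ht)).mono (hsub.trans hrD)).mono ?_)
        exact Metric.closure_ball_subset_closedBall
      · exact hM w (hsub (Metric.sphere_subset_closedBall hw)) _ ⟨t, hIoc ht, rfl⟩)
    (h.integrable.norm.const_mul _)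
    (by
      refine Eventually.of_forall fun t ht z hz => hder t (hIoc ht) z (hrD ?_)
      exact Metric.ball_subset_ball (by linarith) hz)
  exact key.2.differentiableAt

/-- The index of the curve `c` about `w`, times `2πi`. -/
noncomputable def _root_.windingIntegral (a b : ℝ) (c c' : ℝ → ℂ) (w : ℂ) : ℂ :=
  ∫ t in a..b, 1 / (c t - w) * c' t

/-- A closed curve does not wind about `w` if a rotation about `w` brings it into the plane slit
along the negative real axis: a logarithm is then a primitive. -/
lemma windingIntegral_eq_zero (h : IsCurve a b c c') (hc : c a = c b) {w u : ℂ}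
    (hs : ∀ t ∈ Set.Icc a b, u * (c t - w) ∈ Complex.slitPlane) :
    windingIntegral a b c c' w = 0 := by
  have hne : ∀ t ∈ Set.Icc a b, u * (c t - w) ≠ 0 := fun t ht => Complex.slitPlane_ne_zero (hs t ht)
  have hcont : ContinuousOn (fun t => u * (c t - w)) (Set.Icc a b) :=
    continuousOn_const.mul (h.cont.sub continuousOn_const)
  have hw : w ∉ c '' Set.Icc a b := by
    rintro ⟨t, ht, rfl⟩
    simpa using hne t ht
  rw [windingIntegral, h.integral_eq_sub (P := fun t => Complex.log (u * (c t - w)))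
    (p := fun t => 1 / (c t - w)) (hcont.clog hs)
    (h.continuousOn_div_sub continuousOn_const hw), hc, sub_self]
  intro t ht hd
  have ht' := Set.Ioo_subset_Icc_self ht
  have h1 := left_ne_zero_of_mul (hne t ht')
  have h2 := right_ne_zero_of_mul (hne t ht')
  refine (((hd.sub_const w).const_mul u).clog_real (hs t ht')).congr_deriv ?_
  field_simp

/-- The index is locally constant: near `w₀`, the quotient `(c - w) / (c - w₀)` is close to `1`, and
its logarithm is a primitive of the difference of the two integrands. -/
lemma eventually_windingIntegral_eq (h : IsCurve a b c c') (hc : c a = c b) {w₀ : ℂ}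
    (hw : w₀ ∉ c '' Set.Icc a b) :
    ∀ᶠ w in 𝓝 w₀, windingIntegral a b c c' w = windingIntegral a b c c' w₀ := by
  obtain ⟨δ, hδ, hball⟩ := Metric.isOpen_iff.1 h.isCompact_image.isClosed.isOpen_compl w₀ hw
  filter_upwards [Metric.ball_mem_nhds w₀ hδ] with w hwb
  have hn0 : ∀ t ∈ Set.Icc a b, c t - w₀ ≠ 0 := fun t ht h0 => hw ⟨t, ht, sub_eq_zero.1 h0⟩
  have hn : ∀ t ∈ Set.Icc a b, c t - w ≠ 0 := fun t ht h0 =>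
    hball hwb ⟨t, ht, sub_eq_zero.1 h0⟩
  have hs : ∀ t ∈ Set.Icc a b, (c t - w) / (c t - w₀) ∈ Complex.slitPlane := by
    intro t ht
    have h1 : (c t - w) / (c t - w₀) = 1 + (-(w - w₀) / (c t - w₀)) := by
      have := hn0 t ht
      field_simp
      ring
    rw [h1]
    refine Complex.mem_slitPlane_of_norm_lt_one ?_
    rw [norm_div, norm_neg, div_lt_one (norm_pos_iff.2 (hn0 t ht))]
    rw [Metric.mem_ball, dist_eq_norm] at hwb
    refine hwb.trans_le ?_
    by_contra hlt
    refine hball (a := c t) ?_ ⟨t, ht, rfl⟩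
    rw [Metric.mem_ball, dist_eq_norm]
    exact not_le.1 hlt
  have hw1 := h.continuousOn_div_sub (continuousOn_const (c := (1 : ℂ))) (hball hwb)
  have hw0 := h.continuousOn_div_sub (continuousOn_const (c := (1 : ℂ))) hw
  have hcw : ContinuousOn (fun t => c t - w) (Set.Icc a b) := h.cont.sub continuousOn_const
  have hcw0 : ContinuousOn (fun t => c t - w₀) (Set.Icc a b) := h.cont.sub continuousOn_const
  have key := h.integral_eq_sub (P := fun t => Complex.log ((c t - w) / (c t - w₀)))
    (p := fun t => 1 / (c t - w) - 1 / (c t - w₀))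
    ((hcw.div hcw0 hn0).clog hs)
    (hw1.sub hw0) (by
      intro t ht hd
      have ht' := Set.Ioo_subset_Icc_self ht
      have h1 := hn t ht'
      have h2 := hn0 t ht'
      have h3 : HasDerivAt (fun t => (c t - w) / (c t - w₀)) _ t :=
        (hd.sub_const w).div (hd.sub_const w₀) h2
      refine (h3.clog_real (hs t ht')).congr_deriv ?_
      field_simp)
  rw [hc, sub_self] at key
  have hi := intervalIntegral.integral_sub
    (h.intervalIntegrable_mul hw1) (h.intervalIntegrable_mul hw0)
  rw [← sub_eq_zero, windingIntegral, windingIntegral, ← hi, ← key]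
  simp only [sub_mul]

/-- **Cauchy's theorem, homology version.** A closed curve in `D` which does not wind about any
point outside `D` satisfies Cauchy's integral formula. -/
theorem cauchy_formula (h : IsCurve a b c c') (hc : c a = c b) {D : Set ℂ} (hD : IsOpen D)
    (hcD : ∀ t ∈ Set.Icc a b, c t ∈ D) (hind : ∀ w ∉ D, windingIntegral a b c c' w = 0)
    {f : ℂ → ℂ} (hf : DifferentiableOn ℂ f D) {z : ℂ} (hz : z ∈ D) (hzc : z ∉ c '' Set.Icc a b) :
    ∫ t in a..b, f (c t) / (c t - z) * c' t = f z * windingIntegral a b c c' z := by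
  -- Dixon's argument: `h₁` on `D` and `h₂` off `D` are parts of an entire function which vanishes
  -- at infinity
  classical
  set h₁ : ℂ → ℂ := fun z => ∫ t in a..b, dslope f z (c t) * c' t with hh₁
  set h₂ : ℂ → ℂ := fun z => ∫ t in a..b, f (c t) / (c t - z) * c' t with hh₂
  have hfc : ContinuousOn (fun t => f (c t)) (Set.Icc a b) := hf.continuousOn.comp h.cont hcD
  have hrel : ∀ z ∈ D, z ∉ c '' Set.Icc a b → h₁ z = h₂ z - f z * windingIntegral a b c c' z := by
    intro z _ hzc
    have hn := sub_ne_zero_of_notMem hzc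
    rw [hh₁, hh₂, windingIntegral, ← intervalIntegral.integral_const_mul,
      ← intervalIntegral.integral_sub (h.intervalIntegrable_mul (h.continuousOn_div_sub hfc hzc))
        ((h.intervalIntegrable_mul (h.continuousOn_div_sub continuousOn_const hzc)).const_mul _)]
    refine intervalIntegral.integral_congr fun t ht => ?_
    rw [Set.uIcc_of_le h.le] at ht
    have hne : c t ≠ z := sub_ne_zero.1 (hn t ht)
    simp only [dslope_of_ne f hne, slope_def_field]
    ring
  have hout : ∀ w ∉ D, w ∉ c '' Set.Icc a b := by
    rintro w hw ⟨t, ht, rfl⟩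
    exact hw (hcD t ht)
  set H : ℂ → ℂ := fun z => if z ∈ D then h₁ z else h₂ z with hH
  have hdiff : Differentiable ℂ H := by
    intro z₀
    by_cases hz₀ : z₀ ∈ D
    · refine (h.differentiableAt_integral_dslope hD hcD hf hz₀).congr_of_eventuallyEq ?_
      filter_upwards [hD.mem_nhds hz₀] with z hz
      simp [hH, hz, hh₁]
    · refine (h.differentiableAt_cauchy hfc (hout z₀ hz₀)).congr_of_eventuallyEq ?_
      filter_upwards [h.eventually_windingIntegral_eq hc (hout z₀ hz₀),
        h.isCompact_image.isClosed.isOpen_compl.mem_nhds (hout z₀ hz₀)] with z hz1 hz2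
      rw [hind z₀ hz₀] at hz1
      by_cases hzD : z ∈ D
      · simp only [hH, hzD, if_true, hrel z hzD hz2, hz1, mul_zero, sub_zero]
        rfl
      · simp [hH, hzD, hh₂]
  have hlim : Tendsto H (cocompact ℂ) (𝓝 0) := by
    obtain ⟨M, hM⟩ := h.isCompact_image.isBounded.exists_norm_le
    have hM : ∀ t ∈ Set.Icc a b, ‖c t‖ ≤ M := fun t ht => hM _ ⟨t, ht, rfl⟩
    have hIoc : Set.uIoc a b ⊆ Set.Icc a b := by
      rw [Set.uIoc_of_le h.le]; exact Set.Ioc_subset_Icc_self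
    set B : ℝ := ∫ t in a..b, ‖f (c t) * c' t‖ with hB
    have hfar : ∀ᶠ z in cocompact ℂ, M < ‖z‖ :=
      tendsto_norm_cocompact_atTop.eventually (eventually_gt_atTop M)
    have hdom : ∀ᶠ z in cocompact ℂ, ‖H z‖ ≤ B / (‖z‖ - M) := by
      filter_upwards [hfar, tendsto_norm_cocompact_atTop.eventually (eventually_gt_atTop 0)]
        with z hz hz0
      have hzc : z ∉ c '' Set.Icc a b := by
        rintro ⟨t, ht, rfl⟩
        exact (hM t ht).not_gt hz
      have hHz : H z = h₂ z := by
        by_cases hzD : z ∈ D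
        · have hw : windingIntegral a b c c' z = 0 := by
            refine h.windingIntegral_eq_zero hc (u := -z⁻¹) fun t ht => ?_
            have hz' : z ≠ 0 := norm_pos_iff.1 hz0
            have : -z⁻¹ * (c t - z) = 1 + (-(c t) / z) := by
              field_simp
              ring
            rw [this]
            refine Complex.mem_slitPlane_of_norm_lt_one ?_
            rw [norm_div, norm_neg, div_lt_one hz0]
            exact (hM t ht).trans_lt hz
          simp only [hH, hzD, if_true]
          rw [hrel z hzD hzc, hw, mul_zero, sub_zero]
        · simp [hH, hzD]
      have hpos : 0 < ‖z‖ - M := sub_pos.2 hz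
      rw [hHz, hh₂, hB, ← intervalIntegral.integral_div]
      refine intervalIntegral.norm_integral_le_of_norm_le h.le ?_
        ((h.intervalIntegrable_mul hfc).norm.div_const _)
      refine Eventually.of_forall fun t ht => ?_
      have ht' := Set.Ioc_subset_Icc_self ht
      rw [div_mul_eq_mul_div, norm_div]
      have : ‖z‖ - M ≤ ‖c t - z‖ := by
        have := norm_sub_norm_le z (c t)
        rw [norm_sub_rev] at this
        linarith [hM t ht']
      gcongr
    refine squeeze_zero_norm' hdom (tendsto_const_nhds.div_atTop ?_)
    exact tendsto_atTop_add_const_right _ _ tendsto_norm_cocompact_atTop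
  have h0 : H z = 0 := hdiff.apply_eq_of_tendsto_cocompact z hlim
  simp only [hH, hz, if_true, hrel z hz hzc] at h0
  exact sub_eq_zero.1 h0

/-- A closed curve in `D` which does not wind about any point outside `D`, and misses some point of
`D`, satisfies Cauchy's theorem. -/
theorem cauchy_integral_eq_zero (h : IsCurve a b c c') (hc : c a = c b) {D : Set ℂ} (hD : IsOpen D)
    (hcD : ∀ t ∈ Set.Icc a b, c t ∈ D) (hind : ∀ w ∉ D, windingIntegral a b c c' w = 0)
    {f : ℂ → ℂ} (hf : DifferentiableOn ℂ f D) {z : ℂ} (hz : z ∈ D) (hzc : z ∉ c '' Set.Icc a b) :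
    ∫ t in a..b, f (c t) * c' t = 0 := by
  have key := h.cauchy_formula hc hD hcD hind (f := fun w => f w * (w - z))
    (hf.mul (by fun_prop)) hz hzc
  rw [sub_self, mul_zero, zero_mul] at key
  rw [← key]
  refine intervalIntegral.integral_congr fun t ht => ?_
  rw [Set.uIcc_of_le h.le] at ht
  have := sub_ne_zero_of_notMem hzc t ht
  field_simp

end IsCurve

/-! ### Logarithmic integrals along keyhole curves -/

lemma ofReal_sub_mem_slitPlane {z : ℂ} {r : ℝ} (hz : ∀ x : ℝ, r ≤ x → z ≠ x) :
    (r : ℂ) - z ∈ Complex.slitPlane := by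
  rw [Complex.mem_slitPlane_iff]
  by_contra! h
  simp only [Complex.sub_re, Complex.ofReal_re, Complex.sub_im, Complex.ofReal_im] at h
  refine hz z.re (by linarith) (Complex.ext rfl ?_)
  simp only [Complex.ofReal_im]
  linarith

/-- A curve `c` on `[s, e]` which starts at `R > 0`, winds once about each point of `[0, R)`
within `D`, and returns to `R` without meeting the half line `[0, ∞)` in between. The
field `log_le` is what allows to let `r` cross `R` in `∫ g(z) log (r - z) dz`, where the logarithm
is singular at the end points of the curve for `r = R`. The field `log_lift` provides the continuous
branch of `log (-z)` along the curve, end points included: the principal value at `R` itself is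
`log R + πi`, which is the limit at the end of the curve, but not at its start. -/
structure IsKeyhole (s e R : ℝ) (c c' : ℝ → ℂ) (D : Set ℂ) : Prop extends IsCurve s e c c' where
  pos : 0 < R
  start_eq : c s = R
  end_eq : c e = R
  avoids : ∀ t ∈ Set.Ioo s e, ∀ x : ℝ, 0 ≤ x → c t ≠ x
  mem : ∀ t ∈ Set.Icc s e, c t ∈ D
  winds : ∀ x : ℝ, 0 ≤ x → x < R → windingIntegral s e c c' x = 2 * Real.pi * Complex.I
  winds_zero : ∀ w ∉ D, windingIntegral s e c c' w = 0
  log_le : ∃ B : ℝ → ℝ, IntervalIntegrable B volume s e ∧ ∀ r ∈ Set.Icc 0 (2 * R),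
    ∀ t ∈ Set.Ioo s e, ‖Complex.log (r - c t)‖ * ‖c' t‖ ≤ B t
  log_lift : ∃ l : ℝ → ℂ, ContinuousOn l (Set.Icc s e) ∧
    (∀ t ∈ Set.Ioo s e, l t = Complex.log (-c t)) ∧
    l s = Real.log R - Real.pi * Complex.I ∧ l e = Real.log R + Real.pi * Complex.I

namespace IsKeyhole

variable {s e R : ℝ} {c c' : ℝ → ℂ} {D : Set ℂ}

lemma ae_mem_Ioo : ∀ᵐ t : ℝ, t ∈ Set.Ioc s e → t ∈ Set.Ioo s e := by
  have : ∀ᵐ t : ℝ, t ≠ e := by simp [ae_iff]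
  filter_upwards [this] with t ht h
  exact ⟨h.1, lt_of_le_of_ne h.2 ht⟩

lemma ne_ofReal (h : IsKeyhole s e R c c' D) {x : ℝ} (hx : 0 ≤ x) (hxR : x ≠ R) :
    (x : ℂ) ∉ c '' Set.Icc s e := by
  rintro ⟨t, ht, hcx⟩
  rcases ht.1.eq_or_lt with rfl | h1
  · rw [h.start_eq] at hcx
    exact hxR (by exact_mod_cast hcx.symm)
  rcases ht.2.eq_or_lt with rfl | h2
  · rw [h.end_eq] at hcx
    exact hxR (by exact_mod_cast hcx.symm)
  exact h.avoids t ⟨h1, h2⟩ x hx hcx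

lemma ne_zero (h : IsKeyhole s e R c c' D) : ∀ t ∈ Set.Icc s e, c t ≠ 0 := fun t ht h0 =>
  h.ne_ofReal le_rfl h.pos.ne ⟨t, ht, by simpa using h0⟩

lemma sub_mem_slitPlane (h : IsKeyhole s e R c c' D) {r : ℝ} (hr : 0 ≤ r) {t : ℝ}
    (ht : t ∈ Set.Ioo s e) : (r : ℂ) - c t ∈ Complex.slitPlane :=
  ofReal_sub_mem_slitPlane fun x hx => h.avoids t ht x (hr.trans hx)

lemma sub_mem_slitPlane_of_lt (h : IsKeyhole s e R c c' D) {r : ℝ} (hr : R < r) {t : ℝ}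
    (ht : t ∈ Set.Icc s e) : (r : ℂ) - c t ∈ Complex.slitPlane :=
  ofReal_sub_mem_slitPlane fun _ hx hcx =>
    h.ne_ofReal (h.pos.le.trans (hr.le.trans hx)) (hr.trans_le hx).ne' ⟨t, ht, hcx⟩

/-- The integral `∫ g(z) log (r - z) dz` along a keyhole curve. -/
noncomputable def _root_.logIntegral (s e : ℝ) (c c' : ℝ → ℂ) (g : ℂ → ℂ) (r : ℝ) : ℂ :=
  ∫ t in s..e, g (c t) * Complex.log (r - c t) * c' t

lemma aestronglyMeasurable_log (h : IsKeyhole s e R c c' D) {g : ℂ → ℂ}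
    (hg : ContinuousOn g D) (r : ℝ) :
    AEStronglyMeasurable (fun t => g (c t) * Complex.log (r - c t) * c' t)
      (volume.restrict (Set.uIoc s e)) := by
  have hsub : Set.uIoc s e ⊆ Set.Icc s e := by
    rw [Set.uIoc_of_le h.le]; exact Set.Ioc_subset_Icc_self
  have hc : AEStronglyMeasurable c (volume.restrict (Set.uIoc s e)) :=
    (h.cont.mono hsub).aestronglyMeasurable measurableSet_uIoc
  have hgc : AEStronglyMeasurable (fun t => g (c t)) (volume.restrict (Set.uIoc s e)) :=
    ((hg.comp h.cont h.mem).mono hsub).aestronglyMeasurable measurableSet_uIoc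
  refine (hgc.mul ?_).mul h.integrable.aestronglyMeasurable_restrict_uIoc
  exact (Complex.measurable_log.comp_aemeasurable
    (aestronglyMeasurable_const.sub hc).aemeasurable).aestronglyMeasurable

lemma exists_bound (h : IsKeyhole s e R c c' D) {g : ℂ → ℂ} (hg : ContinuousOn g D) :
    ∃ B : ℝ → ℝ, IntervalIntegrable B volume s e ∧ ∀ r ∈ Set.Icc 0 (2 * R),
      ∀ t ∈ Set.Ioo s e, ‖g (c t) * Complex.log (r - c t) * c' t‖ ≤ B t := by
  obtain ⟨B, hB, hle⟩ := h.log_le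
  obtain ⟨M, hM⟩ := (isCompact_Icc.image_of_continuousOn
    (hg.comp h.cont h.mem)).isBounded.exists_norm_le
  refine ⟨fun t => M * B t, hB.const_mul _, fun r hr t ht => ?_⟩
  have h1 : ‖g (c t)‖ ≤ M := hM _ ⟨t, Set.Ioo_subset_Icc_self ht, rfl⟩
  rw [mul_assoc, norm_mul, norm_mul (Complex.log _)]
  exact mul_le_mul h1 (hle r hr t ht) (by positivity) ((norm_nonneg _).trans h1)

lemma intervalIntegrable_log (h : IsKeyhole s e R c c' D) {g : ℂ → ℂ}
    (hg : ContinuousOn g D) {r : ℝ} (hr : r ∈ Set.Icc 0 (2 * R)) :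
    IntervalIntegrable (fun t => g (c t) * Complex.log (r - c t) * c' t) volume s e := by
  obtain ⟨B, hB, hle⟩ := h.exists_bound hg
  refine hB.mono_fun' (h.aestronglyMeasurable_log hg r) ?_
  refine (ae_restrict_iff' measurableSet_uIoc).2 ?_
  rw [Set.uIoc_of_le h.le]
  filter_upwards [ae_mem_Ioo (s := s) (e := e)] with t ht h'
  exact hle r hr t (ht h')

lemma continuousOn_logIntegral (h : IsKeyhole s e R c c' D) {g : ℂ → ℂ}
    (hg : ContinuousOn g D) : ContinuousOn (logIntegral s e c c' g) (Set.Icc 0 (2 * R)) := by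
  obtain ⟨B, hB, hle⟩ := h.exists_bound hg
  intro r hr
  refine intervalIntegral.continuousWithinAt_of_dominated_interval (bound := B)
    (Eventually.of_forall fun r => h.aestronglyMeasurable_log hg r) ?_ hB ?_
  · filter_upwards [self_mem_nhdsWithin] with r hr
    rw [Set.uIoc_of_le h.le]
    filter_upwards [ae_mem_Ioo (s := s) (e := e)] with t ht h'
    exact hle r hr t (ht h')
  · rw [Set.uIoc_of_le h.le]
    filter_upwards [ae_mem_Ioo (s := s) (e := e)] with t ht h'
    refine ContinuousWithinAt.mul (ContinuousWithinAt.mul continuousWithinAt_const ?_)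
      continuousWithinAt_const
    refine ContinuousWithinAt.clog ?_ (h.sub_mem_slitPlane hr.1 (ht h'))
    exact (Complex.continuous_ofReal.sub continuous_const).continuousWithinAt

/-- For `r > R` the curve does not meet the cut `[r, ∞)` of `log (r - z)`, nor does it wind about
its points. -/
lemma logIntegral_eq_zero_of_lt (h : IsKeyhole s e R c c' D) (hD : IsOpen D) (h0 : (0 : ℂ) ∈ D)
    {g : ℂ → ℂ} (hg : DifferentiableOn ℂ g D) {r : ℝ} (hr : R < r) :
    logIntegral s e c c' g r = 0 := by
  have hclosed : c s = c e := h.start_eq.trans h.end_eq.symm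
  have hr0 : 0 < r := h.pos.trans hr
  refine h.cauchy_integral_eq_zero hclosed
    (D := D ∩ (fun z : ℂ => (r : ℂ) - z) ⁻¹' Complex.slitPlane) (z := 0)
    (f := fun z => g z * Complex.log (r - z)) ?_ ?_ ?_ ?_ ?_ ?_
  · exact hD.inter (Complex.isOpen_slitPlane.preimage (by fun_prop))
  · exact fun t ht => ⟨h.mem t ht, h.sub_mem_slitPlane_of_lt hr ht⟩
  · intro w hw
    by_cases hwD : w ∈ D
    · have hw' : (r : ℂ) - w ∉ Complex.slitPlane := fun hs => hw ⟨hwD, hs⟩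
      rw [Complex.mem_slitPlane_iff, not_or, not_not] at hw'
      simp only [Complex.sub_re, Complex.ofReal_re, Complex.sub_im, Complex.ofReal_im, not_lt]
        at hw'
      have hwe : w = (w.re : ℂ) := by
        apply Complex.ext
        · simp
        · simp only [Complex.ofReal_im]; linarith
      refine h.windingIntegral_eq_zero hclosed (u := -1) fun t ht => ?_
      rw [hwe, neg_one_mul, neg_sub]
      exact h.sub_mem_slitPlane_of_lt (by linarith) ht
    · exact h.winds_zero w hwD
  · intro z hz
    refine ((hg z hz.1).mono Set.inter_subset_left).mul (DifferentiableWithinAt.clog ?_ hz.2)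
    fun_prop
  · refine ⟨h0, ?_⟩
    simp [Complex.mem_slitPlane_iff, hr0]
  · exact_mod_cast h.ne_ofReal le_rfl h.pos.ne

/-- The derivative in `r` of `∫ g(z) log (r - z) dz` is a Cauchy integral. -/
lemma hasDerivAt_logIntegral (h : IsKeyhole s e R c c' D) (hD : IsOpen D)
    (hDR : ∀ x : ℝ, 0 ≤ x → (x : ℂ) ∈ D)
    {g : ℂ → ℂ} (hg : DifferentiableOn ℂ g D) {r : ℝ} (hr : r ∈ Set.Ioo 0 R) :
    HasDerivAt (logIntegral s e c c' g) (-(2 * Real.pi * Complex.I) * g r) r := by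
  have hclosed : c s = c e := h.start_eq.trans h.end_eq.symm
  have hrc := h.ne_ofReal hr.1.le hr.2.ne
  obtain ⟨δ, hδ, hball⟩ := Metric.isOpen_iff.1 h.isCompact_image.isClosed.isOpen_compl (r : ℂ) hrc
  set η := min (δ / 2) (min r R) with hη
  have hη0 : 0 < η := by
    rw [hη]; exact lt_min (by linarith) (lt_min hr.1 h.pos)
  have hηδ : η ≤ δ / 2 := min_le_left _ _
  have hηr : η ≤ r := (min_le_right _ _).trans (min_le_left _ _)
  have hηR : η ≤ R := (min_le_right _ _).trans (min_le_right _ _)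
  have hpos : ∀ x ∈ Metric.ball r η, 0 ≤ x ∧ x ≤ 2 * R := by
    intro x hx
    rw [Metric.mem_ball, Real.dist_eq, abs_lt] at hx
    constructor <;> linarith [hr.1, hr.2]
  have hdist : ∀ t ∈ Set.Icc s e, ∀ x ∈ Metric.ball r η, δ / 2 ≤ ‖(x : ℂ) - c t‖ := by
    intro t ht x hx
    by_contra! hlt
    refine hball (a := c t) ?_ ⟨t, ht, rfl⟩
    rw [Metric.mem_ball, Real.dist_eq] at hx
    rw [Metric.mem_ball, dist_eq_norm]
    calc ‖c t - r‖ = ‖((x - r : ℝ) : ℂ) - (x - c t)‖ := by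
          congr 1
          push_cast
          ring
      _ ≤ ‖((x - r : ℝ) : ℂ)‖ + ‖(x : ℂ) - c t‖ := norm_sub_le _ _
      _ < δ := by
          rw [Complex.norm_real, Real.norm_eq_abs]
          linarith
  have hgc : ContinuousOn (fun t => g (c t)) (Set.Icc s e) := hg.continuousOn.comp h.cont h.mem
  have hF'int : IntervalIntegrable (fun t => g (c t) / (r - c t) * c' t) volume s e := by
    refine ((h.intervalIntegrable_mul (h.continuousOn_div_sub hgc hrc)).neg).congr fun t ht => ?_
    simp only [Pi.neg_apply]
    rw [← neg_mul, ← div_neg, neg_sub]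
  have key := intervalIntegral.hasDerivAt_integral_of_dominated_loc_of_deriv_le (μ := volume)
    (F := fun (x : ℝ) t => g (c t) * Complex.log (x - c t) * c' t)
    (F' := fun (x : ℝ) t => g (c t) / (x - c t) * c' t) (x₀ := r) (a := s) (b := e)
    (bound := fun t => ‖g (c t) * c' t‖ / (δ / 2))
    (Metric.ball_mem_nhds r hη0)
    (Eventually.of_forall fun x => h.aestronglyMeasurable_log hg.continuousOn x)
    (h.intervalIntegrable_log hg.continuousOn (hpos r (Metric.mem_ball_self hη0)))
    hF'int.aestronglyMeasurable_restrict_uIoc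
    (by
      refine Eventually.of_forall fun t ht x hx => ?_
      rw [Set.uIoc_of_le h.le] at ht
      have h1 := hdist t (Set.Ioc_subset_Icc_self ht) x hx
      rw [div_mul_eq_mul_div, norm_div]
      gcongr)
    ((h.intervalIntegrable_mul hgc).norm.div_const _)
    (by
      rw [Set.uIoc_of_le h.le]
      filter_upwards [ae_mem_Ioo (s := s) (e := e)] with t ht h' x hx
      have h1 : HasDerivAt (fun x : ℝ => (x : ℂ) - c t) 1 x :=
        Complex.ofRealCLM.hasDerivAt.sub_const _
      have h2 := h1.clog_real (h.sub_mem_slitPlane (hpos x hx).1 (ht h'))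
      refine ((h2.const_mul (g (c t))).mul_const (c' t)).congr_deriv ?_
      rw [mul_one_div])
  refine key.2.congr_deriv ?_
  have hcauchy := h.cauchy_formula hclosed hD h.mem h.winds_zero hg (hDR r hr.1.le) hrc
  rw [h.winds r hr.1.le hr.2] at hcauchy
  rw [neg_mul, mul_comm, ← hcauchy, ← intervalIntegral.integral_neg]
  refine intervalIntegral.integral_congr fun t _ => ?_
  rw [← neg_mul, ← div_neg, neg_sub]

/-- The jump of the logarithm across `[0, R]` turns the integral of `g(z) log (-z)` along a keyhole
curve into an integral over `[0, R]`. -/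
theorem integral_mul_log (h : IsKeyhole s e R c c' D) (hD : IsOpen D)
    (hDR : ∀ x : ℝ, 0 ≤ x → (x : ℂ) ∈ D) {g : ℂ → ℂ} (hg : DifferentiableOn ℂ g D) :
    ∫ t in s..e, g (c t) * Complex.log (-c t) * c' t =
      2 * Real.pi * Complex.I * ∫ x in (0 : ℝ)..R, g x := by
  have hcont := h.continuousOn_logIntegral hg.continuousOn
  have hR := h.pos
  have hzero : logIntegral s e c c' g R = 0 := by
    have hlim : Tendsto (logIntegral s e c c' g) (𝓝[Set.Ioc R (2 * R)] R)
        (𝓝 (logIntegral s e c c' g R)) :=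
      (hcont R ⟨hR.le, by linarith⟩).mono fun x hx => ⟨hR.le.trans hx.1.le, hx.2⟩
    have : NeBot (𝓝[Set.Ioc R (2 * R)] R) := by
      rw [nhdsWithin_Ioc_eq_nhdsGT (by linarith)]
      infer_instance
    refine tendsto_nhds_unique hlim (tendsto_const_nhds.congr' ?_)
    filter_upwards [self_mem_nhdsWithin] with x hx
    exact (h.logIntegral_eq_zero_of_lt hD (by simpa using hDR 0 le_rfl) hg hx.1).symm
  have hftc := intervalIntegral.integral_eq_sub_of_hasDerivAt_of_le hR.le
    (hcont.mono (Set.Icc_subset_Icc_right (by linarith)))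
    (fun r hr => h.hasDerivAt_logIntegral hD hDR hg hr)
    (by
      refine ContinuousOn.intervalIntegrable ?_
      rw [Set.uIcc_of_le hR.le]
      exact continuousOn_const.mul (hg.continuousOn.comp Complex.continuous_ofReal.continuousOn
        fun x hx => hDR x hx.1))
  rw [intervalIntegral.integral_const_mul, hzero, zero_sub, neg_mul, neg_inj] at hftc
  rw [hftc, logIntegral]
  simp only [Complex.ofReal_zero, zero_sub]

lemma log_ae_eq (h : IsKeyhole s e R c c' D) {l : ℝ → ℂ}
    (hl : ∀ t ∈ Set.Ioo s e, l t = Complex.log (-c t)) (p : ℝ → ℂ) :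
    ∀ᵐ t : ℝ, t ∈ Set.uIoc s e →
      p t * l t * c' t = p t * Complex.log (-c t) * c' t := by
  rw [Set.uIoc_of_le h.le]
  filter_upwards [ae_mem_Ioo (s := s) (e := e)] with t ht h'
  rw [hl t (ht h')]

lemma hasDerivAt_log (h : IsKeyhole s e R c c' D) {l : ℝ → ℂ}
    (hl : ∀ t ∈ Set.Ioo s e, l t = Complex.log (-c t)) {t : ℝ} (ht : t ∈ Set.Ioo s e)
    (hd : HasDerivAt c (c' t) t) : HasDerivAt l (c' t / c t) t := by
  have h1 : -c t ∈ Complex.slitPlane := by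
    simpa using h.sub_mem_slitPlane le_rfl ht
  have h2 : HasDerivAt (fun t => Complex.log (-c t)) (-c' t / -c t) t := hd.fun_neg.clog_real h1
  rw [neg_div_neg_eq] at h2
  refine h2.congr_of_eventuallyEq ?_
  filter_upwards [Ioo_mem_nhds ht.1 ht.2] with u hu
  exact hl u hu

/-- Integrals of `z ^ m log (-z)` along a keyhole curve, from an explicit primitive. The curve
runs from the lower to the upper value `log R ∓ πi` of the logarithm at `R`. -/
lemma integral_zpow_mul_log (h : IsKeyhole s e R c c' D) {m : ℤ} (hm : m + 1 ≠ 0) :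
    ∫ t in s..e, c t ^ m * Complex.log (-c t) * c' t =
      2 * Real.pi * Complex.I * ((R : ℂ) ^ (m + 1) / (m + 1)) := by
  obtain ⟨l, hlc, hl, hls, hle⟩ := h.log_lift
  have hm' : (m : ℂ) + 1 ≠ 0 := by exact_mod_cast hm
  have hpow : ∀ k : ℤ, ContinuousOn (fun t => c t ^ k) (Set.Icc s e) := fun k =>
    h.cont.zpow₀ k fun t ht => Or.inl (h.ne_zero t ht)
  rw [← intervalIntegral.integral_congr_ae (h.log_ae_eq hl _),
    h.integral_eq_sub (P := fun t => c t ^ (m + 1) / (m + 1) * (l t - 1 / (m + 1)))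
      (p := fun t => c t ^ m * l t)
      (((hpow (m + 1)).div_const _).mul (hlc.sub continuousOn_const)) ((hpow m).mul hlc)]
  · simp only [h.start_eq, h.end_eq, hls, hle]
    ring
  · intro t ht hd
    have hct := h.ne_zero t (Set.Ioo_subset_Icc_self ht)
    have hlog := h.hasDerivAt_log hl ht hd
    have hp : HasDerivAt (fun t => c t ^ (m + 1)) (((m + 1 : ℤ) : ℂ) * c t ^ m * c' t) t := by
      have := (hasDerivAt_zpow (m + 1) (c t) (Or.inl hct)).comp t hd
      rwa [add_sub_cancel_right] at this
    refine ((hp.div_const ((m : ℂ) + 1)).mul (hlog.sub_const (1 / ((m : ℂ) + 1)))).congr_deriv ?_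
    push_cast
    rw [zpow_add_one₀ hct]
    field_simp
    ring

lemma integral_inv_mul_log (h : IsKeyhole s e R c c' D) :
    ∫ t in s..e, c t ^ (-1 : ℤ) * Complex.log (-c t) * c' t =
      2 * Real.pi * Complex.I * Real.log R := by
  obtain ⟨l, hlc, hl, hls, hle⟩ := h.log_lift
  have hpow : ContinuousOn (fun t => c t ^ (-1 : ℤ)) (Set.Icc s e) :=
    h.cont.zpow₀ _ fun t ht => Or.inl (h.ne_zero t ht)
  rw [← intervalIntegral.integral_congr_ae (h.log_ae_eq hl _),
    h.integral_eq_sub (P := fun t => l t ^ 2 / 2) (p := fun t => c t ^ (-1 : ℤ) * l t)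
      ((hlc.pow 2).div_const _) (hpow.mul hlc)]
  · simp only [hls, hle]
    ring
  · intro t ht hd
    have hlog := h.hasDerivAt_log hl ht hd
    refine ((hlog.pow 2).div_const 2).congr_deriv ?_
    rw [zpow_neg_one]
    push_cast
    ring

end IsKeyhole

/-! ### The finite part as the limit of a primitive -/

/-- The remainder `g` in Taylor's formula `f z = ∑_{k<n} f⁽ᵏ⁾(0) / k! z ^ k + z ^ n g z`, as an
iterated difference quotient at `0`. -/
noncomputable def taylorRemainder (n : ℕ) (f : ℂ → ℂ) : ℂ → ℂ := (Function.swap dslope 0)^[n] f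

lemma differentiableOn_taylorRemainder {D : Set ℂ} (hD : IsOpen D) (h0 : (0 : ℂ) ∈ D)
    {f : ℂ → ℂ} (hf : DifferentiableOn ℂ f D) (n : ℕ) :
    DifferentiableOn ℂ (taylorRemainder n f) D := by
  induction n with
  | zero => exact hf
  | succ n ih =>
    rw [taylorRemainder, Function.iterate_succ_apply']
    exact (Complex.differentiableOn_dslope (hD.mem_nhds h0)).2 ih

lemma taylorRemainder_zero {f : ℂ → ℂ} (hf : AnalyticAt ℂ f 0) (n : ℕ) :
    taylorRemainder n f 0 = iteratedDeriv n f 0 / n.factorial := by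
  have h := hf.hasFPowerSeriesAt.has_fpower_series_iterate_dslope_fslope n
  have h1 := h.coeff_zero 1
  rw [← FormalMultilinearSeries.coeff, FormalMultilinearSeries.coeff_iterate_fslope,
    zero_add, FormalMultilinearSeries.coeff_ofScalars] at h1
  exact h1.symm

lemma eq_sum_add_taylorRemainder {f : ℂ → ℂ} (hf : AnalyticAt ℂ f 0) (n : ℕ) (z : ℂ) :
    f z = ∑ k ∈ Finset.range n, iteratedDeriv k f 0 / k.factorial * z ^ k +
      z ^ n * taylorRemainder n f z := by
  induction n with
  | zero => simp [taylorRemainder]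
  | succ n ih =>
    have h1 : z * taylorRemainder (n + 1) f z =
        taylorRemainder n f z - taylorRemainder n f 0 := by
      have := sub_smul_dslope (taylorRemainder n f) 0 z
      rw [sub_zero, smul_eq_mul] at this
      rw [← this, taylorRemainder, taylorRemainder, Function.iterate_succ_apply']
    rw [Finset.sum_range_succ, pow_succ, mul_assoc, h1, taylorRemainder_zero hf]
    nth_rw 1 [ih]
    ring

/-- The Laurent expansion at `0` of the integrand `z ^ (-n) f z`. -/
lemma zpow_neg_mul_eq {n : ℕ} (hn : 1 ≤ n) {f : ℂ → ℂ} (hf : AnalyticAt ℂ f 0) {z : ℂ}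
    (hz : z ≠ 0) :
    z ^ (-(n : ℤ)) * f z = ∑ k ∈ Finset.range (n - 1),
        iteratedDeriv k f 0 / k.factorial * z ^ ((k : ℤ) - n) +
      iteratedDeriv (n - 1) f 0 / (n - 1).factorial * z ^ (-1 : ℤ) + taylorRemainder n f z := by
  obtain ⟨m, rfl⟩ : ∃ m, n = m + 1 := ⟨n - 1, by omega⟩
  have hk : ∀ k : ℕ, z ^ (-((m + 1 : ℕ) : ℤ)) * z ^ k = z ^ ((k : ℤ) - (m + 1 : ℕ)) := fun k => by
    rw [← zpow_natCast z k, ← zpow_add₀ hz, neg_add_eq_sub]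
  have e1 : (-1 : ℤ) = (m : ℤ) - (m + 1 : ℕ) := by push_cast; ring
  have e2 : z ^ (-((m + 1 : ℕ) : ℤ)) * z ^ (m + 1) = 1 := by rw [hk, sub_self, zpow_zero]
  rw [eq_sum_add_taylorRemainder hf (m + 1) z, Finset.sum_range_succ, add_tsub_cancel_right, e1,
    ← hk m, mul_add, mul_add, Finset.mul_sum, ← mul_assoc (z ^ _) (z ^ (m + 1)), e2, one_mul]
  congr 2
  · refine Finset.sum_congr rfl fun k _ => ?_
    rw [← hk k]
    ring
  · ring

/-- The primitive of `x ^ (-n) f x` on `(0, ∞)` without constant term in its expansion at `0`. The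
Hadamard finite part of the integral is the limit of this function at `∞`. -/
noncomputable def fpPrimitive (n : ℕ) (f : ℂ → ℂ) (x : ℝ) : ℂ :=
  -(∑ k ∈ Finset.range (n - 1),
      (x : ℂ) ^ ((k : ℤ) + 1 - (n : ℤ)) / ((k.factorial : ℂ) * ((n : ℂ) - 1 - (k : ℂ)))
        * iteratedDeriv k f 0)
    + (Real.log x : ℂ) / ((n - 1).factorial : ℂ) * iteratedDeriv (n - 1) f 0
    + ∫ y in (0 : ℝ)..x, taylorRemainder n f y

lemma fpTruncated_eq (n : ℕ) (f : ℂ → ℂ) (ε : ℝ) :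
    fpTruncated n f ε = (∫ x in Set.Ioi ε, (x : ℂ) ^ (-(n : ℤ)) * f (x : ℂ)) +
      fpPrimitive n f ε - ∫ y in (0 : ℝ)..ε, taylorRemainder n f y := by
  rw [fpTruncated, fpPrimitive]
  ring

section

variable {n : ℕ} {D : Set ℂ} {f : ℂ → ℂ}

lemma coeff_ne_zero {k : ℕ} (hk : k ∈ Finset.range (n - 1)) : (n : ℂ) - 1 - k ≠ 0 := by
  have hk' : k + 1 < n := by
    have := Finset.mem_range.1 hk
    omega
  rw [sub_sub, sub_ne_zero]
  exact_mod_cast (by omega : n ≠ 1 + k)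

lemma continuousOn_taylorRemainder_ofReal (hD : IsOpen D) (hDR : ∀ x : ℝ, 0 ≤ x → (x : ℂ) ∈ D)
    (hf : DifferentiableOn ℂ f D) (n : ℕ) :
    ContinuousOn (fun x : ℝ => taylorRemainder n f x) (Set.Ici 0) :=
  (differentiableOn_taylorRemainder hD (by simpa using hDR 0 le_rfl) hf n).continuousOn.comp
    Complex.continuous_ofReal.continuousOn fun x hx => hDR x hx

lemma hasDerivAt_fpPrimitive (hn : 1 ≤ n) (hD : IsOpen D) (hDR : ∀ x : ℝ, 0 ≤ x → (x : ℂ) ∈ D)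
    (hf : DifferentiableOn ℂ f D) {x : ℝ} (hx : 0 < x) :
    HasDerivAt (fpPrimitive n f) ((x : ℂ) ^ (-(n : ℤ)) * f x) x := by
  have hx0 : (x : ℂ) ≠ 0 := by exact_mod_cast hx.ne'
  have h0 : (0 : ℂ) ∈ D := by simpa using hDR 0 le_rfl
  have hcont := continuousOn_taylorRemainder_ofReal hD hDR hf n
  have hpow : ∀ k ∈ Finset.range (n - 1), HasDerivAt (fun x : ℝ =>
      (x : ℂ) ^ ((k : ℤ) + 1 - (n : ℤ)) / ((k.factorial : ℂ) * ((n : ℂ) - 1 - (k : ℂ)))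
        * iteratedDeriv k f 0)
      (-(iteratedDeriv k f 0 / k.factorial * (x : ℂ) ^ ((k : ℤ) - n))) x := by
    intro k hk
    have h1 := (hasDerivAt_zpow ((k : ℤ) + 1 - n) (x : ℂ) (Or.inl hx0)).comp_ofReal
    have hne := coeff_ne_zero hk
    have hfac : (k.factorial : ℂ) ≠ 0 := by exact_mod_cast k.factorial_ne_zero
    refine ((h1.div_const _).mul_const _).congr_deriv ?_
    rw [show (k : ℤ) + 1 - n - 1 = k - n by ring]
    push_cast
    field_simp
    ring
  have hlog : HasDerivAt (fun x : ℝ => (Real.log x : ℂ)) ((x : ℂ) ^ (-1 : ℤ)) x := by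
    have := (Real.hasDerivAt_log hx.ne').ofReal_comp
    rwa [Complex.ofReal_inv, ← zpow_neg_one] at this
  have hint : HasDerivAt (fun x : ℝ => ∫ y in (0 : ℝ)..x, taylorRemainder n f y)
      (taylorRemainder n f x) x := by
    refine intervalIntegral.integral_hasDerivAt_right ?_ ?_ (hcont.continuousAt (Ici_mem_nhds hx))
    · refine (hcont.mono ?_).intervalIntegrable
      rw [Set.uIcc_of_le hx.le]
      exact Set.Icc_subset_Ici_self
    · exact (hcont.mono Set.Ioi_subset_Ici_self).stronglyMeasurableAtFilter isOpen_Ioi x hx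
  have hsum := HasDerivAt.fun_sum hpow
  refine ((hsum.fun_neg.add ((hlog.div_const _).mul_const _)).add hint).congr_deriv ?_
  rw [zpow_neg_mul_eq hn (hf.analyticAt (hD.mem_nhds h0)) hx0, Finset.sum_neg_distrib, neg_neg]
  ring

lemma continuousOn_zpow_neg_mul (hDR : ∀ x : ℝ, 0 ≤ x → (x : ℂ) ∈ D)
    (hf : ContinuousOn f D) : ContinuousOn (fun x : ℝ => (x : ℂ) ^ (-(n : ℤ)) * f x)
      (Set.Ioi 0) := by
  refine ContinuousOn.mul ?_ (hf.comp Complex.continuous_ofReal.continuousOn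
    fun x hx => hDR x (le_of_lt hx))
  refine Complex.continuous_ofReal.continuousOn.zpow₀ _ fun x hx => Or.inl ?_
  exact_mod_cast (ne_of_gt hx)

/-- The growth condition in the form of an explicit bound for the integrand near infinity. -/
lemma exists_norm_zpow_neg_mul_le {α : ℝ}
    (hgrowth : f =O[cocompact ℂ ⊓ 𝓟 D] fun z : ℂ => ‖z‖ ^ ((n : ℝ) - 1 - α)) :
    ∃ C X : ℝ, 0 < C ∧ 1 ≤ X ∧ ∀ z ∈ D, X ≤ ‖z‖ →
      ‖z ^ (-(n : ℤ)) * f z‖ ≤ C * ‖z‖ ^ (-1 - α) := by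
  obtain ⟨C, hC, hle⟩ := hgrowth.exists_pos
  have h1 := eventually_inf_principal.1 hle.bound
  rw [← Metric.cobounded_eq_cocompact, ← comap_norm_atTop, eventually_comap, eventually_atTop] at h1
  obtain ⟨X, hX⟩ := h1
  refine ⟨C, max X 1, hC, le_max_right _ _, fun z hz hzX => ?_⟩
  have hz1 : 0 < ‖z‖ := zero_lt_one.trans_le ((le_max_right _ _).trans hzX)
  have h2 := hX ‖z‖ ((le_max_left _ _).trans hzX) z rfl hz
  rw [Real.norm_of_nonneg (by positivity)] at h2
  have h3 : ‖z‖ ^ (-1 - α) = ‖z‖ ^ (-(n : ℤ)) * ‖z‖ ^ ((n : ℝ) - 1 - α) := by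
    rw [← Real.rpow_intCast, ← Real.rpow_add hz1]
    congr 1
    push_cast
    ring
  rw [norm_mul, norm_zpow, h3, mul_left_comm]
  gcongr

lemma integrableOn_zpow_neg_mul {α : ℝ} (hα : 0 < α) (hDR : ∀ x : ℝ, 0 ≤ x → (x : ℂ) ∈ D)
    (hf : ContinuousOn f D)
    (hgrowth : f =O[cocompact ℂ ⊓ 𝓟 D] fun z : ℂ => ‖z‖ ^ ((n : ℝ) - 1 - α))
    {ε : ℝ} (hε : 0 < ε) :
    IntegrableOn (fun x : ℝ => (x : ℂ) ^ (-(n : ℤ)) * f (x : ℂ)) (Set.Ioi ε) := by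
  obtain ⟨C, X, hC, hX, hle⟩ := exists_norm_zpow_neg_mul_le hgrowth
  have hcont := continuousOn_zpow_neg_mul (n := n) hDR hf
  have hloc : LocallyIntegrableOn (fun x : ℝ => (x : ℂ) ^ (-(n : ℤ)) * f (x : ℂ)) (Set.Ici ε) :=
    (hcont.mono fun x hx => hε.trans_le hx).locallyIntegrableOn measurableSet_Ici
  refine (hloc.integrableOn_of_isBigO_atTop (g := fun x : ℝ => x ^ (-1 - α)) ?_ ?_).mono_set
    Set.Ioi_subset_Ici_self
  · refine IsBigO.of_bound C ?_
    filter_upwards [eventually_ge_atTop X] with x hx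
    have hx0 : 0 ≤ x := zero_le_one.trans (hX.trans hx)
    have hnorm : ‖(x : ℂ)‖ = x := by rw [Complex.norm_real, Real.norm_of_nonneg hx0]
    have := hle x (hDR x hx0) (by rwa [hnorm])
    rw [hnorm] at this
    rwa [Real.norm_of_nonneg (by positivity : (0 : ℝ) ≤ x ^ (-1 - α))]
  · exact ⟨Set.Ioi 1, Ioi_mem_atTop 1, integrableOn_Ioi_rpow_of_lt (by linarith) one_pos⟩

/-- The finite-part integral exists, and is the limit of the normalised primitive. -/
theorem exists_isFinitePartIntegral (hn : 1 ≤ n) {α : ℝ} (hα : 0 < α) (hD : IsOpen D)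
    (hDR : ∀ x : ℝ, 0 ≤ x → (x : ℂ) ∈ D) (hf : DifferentiableOn ℂ f D)
    (hgrowth : f =O[cocompact ℂ ⊓ 𝓟 D] fun z : ℂ => ‖z‖ ^ ((n : ℝ) - 1 - α)) :
    ∃ I : ℂ, IsFinitePartIntegral n f I ∧ Tendsto (fpPrimitive n f) atTop (𝓝 I) := by
  have hint : ∀ ε : ℝ, 0 < ε →
      IntegrableOn (fun x : ℝ => (x : ℂ) ^ (-(n : ℤ)) * f (x : ℂ)) (Set.Ioi ε) := fun ε hε =>
    integrableOn_zpow_neg_mul hα hDR hf.continuousOn hgrowth hε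
  have hlim : ∀ ε : ℝ, 0 < ε → Tendsto (fpPrimitive n f) atTop
      (𝓝 ((∫ x in Set.Ioi ε, (x : ℂ) ^ (-(n : ℤ)) * f (x : ℂ)) + fpPrimitive n f ε)) := by
    intro ε hε
    refine ((intervalIntegral_tendsto_integral_Ioi ε (hint ε hε) tendsto_id).add_const
      (fpPrimitive n f ε)).congr' ?_
    filter_upwards [eventually_ge_atTop ε] with X hX
    have hsub : ∀ x ∈ Set.uIcc ε X, 0 < x := fun x hx => by
      rw [Set.uIcc_of_le hX] at hx
      exact hε.trans_le hx.1
    rw [id, intervalIntegral.integral_eq_sub_of_hasDerivAt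
      (fun x hx => hasDerivAt_fpPrimitive hn hD hDR hf (hsub x hx))
      ((continuousOn_zpow_neg_mul hDR hf.continuousOn).mono hsub).intervalIntegrable,
      sub_add_cancel]
  refine ⟨_, ⟨hint, ?_⟩, hlim 1 one_pos⟩
  have hsmall : Tendsto (fun ε : ℝ => ∫ y in (0 : ℝ)..ε, taylorRemainder n f y) (𝓝[>] 0)
      (𝓝 0) := by
    have hcont := continuousOn_taylorRemainder_ofReal hD hDR hf n
    have h1 : ContinuousOn (fun ε : ℝ => ∫ y in (0 : ℝ)..ε, taylorRemainder n f y)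
        (Set.Icc 0 1) := by
      rw [← Set.uIcc_of_le (zero_le_one' ℝ)]
      refine intervalIntegral.continuousOn_primitive_interval ?_
      rw [Set.uIcc_of_le (zero_le_one' ℝ)]
      exact (hcont.mono Set.Icc_subset_Ici_self).integrableOn_Icc
    have h2 := (h1 0 ⟨le_rfl, zero_le_one⟩).mono (Set.Ioc_subset_Icc_self)
    rw [ContinuousWithinAt, nhdsWithin_Ioc_eq_nhdsGT one_pos,
      intervalIntegral.integral_same] at h2
    exact h2
  have h3 := (tendsto_const_nhds (x := (∫ x in Set.Ioi (1 : ℝ), (x : ℂ) ^ (-(n : ℤ)) * f (x : ℂ)) +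
    fpPrimitive n f 1)).sub hsmall
  rw [sub_zero] at h3
  refine h3.congr' ?_
  filter_upwards [self_mem_nhdsWithin] with ε hε
  rw [fpTruncated_eq, tendsto_nhds_unique (hlim 1 one_pos) (hlim ε hε)]

/-- The contour integral over a keyhole curve which starts and ends at `R` is the value at `R` of
the normalised primitive. -/
theorem IsKeyhole.integral_eq_fpPrimitive {s e R : ℝ} {c c' : ℝ → ℂ}
    (h : IsKeyhole s e R c c' D) (hn : 1 ≤ n) (hD : IsOpen D)
    (hDR : ∀ x : ℝ, 0 ≤ x → (x : ℂ) ∈ D) (hf : DifferentiableOn ℂ f D) :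
    IntervalIntegrable (fun t => c t ^ (-(n : ℤ)) * f (c t) * Complex.log (-c t) * c' t)
        volume s e ∧
      ∫ t in s..e, c t ^ (-(n : ℤ)) * f (c t) * Complex.log (-c t) * c' t =
        2 * Real.pi * Complex.I * fpPrimitive n f R := by
  have h0 : (0 : ℂ) ∈ D := by simpa using hDR 0 le_rfl
  have hg := differentiableOn_taylorRemainder hD h0 hf n
  obtain ⟨l, hlc, hl, -, -⟩ := h.log_lift
  have hintl : ∀ p : ℝ → ℂ, ContinuousOn p (Set.Icc s e) →
      IntervalIntegrable (fun t => p t * Complex.log (-c t) * c' t) volume s e := fun p hp =>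
    (h.intervalIntegrable_mul (hp.mul hlc)).congr_ae
      ((ae_restrict_iff' measurableSet_uIoc).2 (h.log_ae_eq hl p))
  have hpow : ∀ k : ℤ, ContinuousOn (fun t => c t ^ k) (Set.Icc s e) := fun k =>
    h.cont.zpow₀ k fun t ht => Or.inl (h.ne_zero t ht)
  refine ⟨hintl _ ((hpow _).mul (hf.continuousOn.comp h.cont h.mem)), ?_⟩
  have hexp : ∫ t in s..e, c t ^ (-(n : ℤ)) * f (c t) * Complex.log (-c t) * c' t =
      ∫ t in s..e, ((∑ k ∈ Finset.range (n - 1), iteratedDeriv k f 0 / k.factorial *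
        (c t ^ ((k : ℤ) - n) * Complex.log (-c t) * c' t)) +
      iteratedDeriv (n - 1) f 0 / (n - 1).factorial *
        (c t ^ (-1 : ℤ) * Complex.log (-c t) * c' t) +
      taylorRemainder n f (c t) * Complex.log (-c t) * c' t) := by
    refine intervalIntegral.integral_congr fun t ht => ?_
    rw [Set.uIcc_of_le h.le] at ht
    rw [zpow_neg_mul_eq hn (hf.analyticAt (hD.mem_nhds h0)) (h.ne_zero t ht), add_mul, add_mul,
      add_mul, add_mul, Finset.sum_mul, Finset.sum_mul]
    congr 2
    · refine Finset.sum_congr rfl fun k _ => ?_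
      ring
    · ring
  have i1 : ∀ k ∈ Finset.range (n - 1), IntervalIntegrable (fun t =>
      iteratedDeriv k f 0 / k.factorial * (c t ^ ((k : ℤ) - n) * Complex.log (-c t) * c' t))
      volume s e := fun k _ => (hintl _ (hpow _)).const_mul _
  have i2 := (hintl _ (hpow (-1))).const_mul (iteratedDeriv (n - 1) f 0 / (n - 1).factorial)
  have i3 := hintl _ (hg.continuousOn.comp h.cont h.mem)
  have i4 : IntervalIntegrable (fun t => ∑ k ∈ Finset.range (n - 1),
      iteratedDeriv k f 0 / k.factorial * (c t ^ ((k : ℤ) - n) * Complex.log (-c t) * c' t))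
      volume s e := by
    simpa [Finset.sum_fn] using IntervalIntegrable.sum _ i1
  have hI := intervalIntegral.integral_add (i4.add i2) i3
  have hI2 := intervalIntegral.integral_add i4 i2
  simp only [Function.comp_apply] at hI
  rw [hexp, hI, hI2, intervalIntegral.integral_finsetSum i1, intervalIntegral.integral_const_mul,
    h.integral_inv_mul_log, h.integral_mul_log hD hDR hg, fpPrimitive, mul_add, mul_add]
  congr 2
  · rw [mul_neg, Finset.mul_sum, ← Finset.sum_neg_distrib]
    refine Finset.sum_congr rfl fun k hk => ?_
    have hne := coeff_ne_zero hk
    have hne' : (((k : ℤ) - n : ℤ) : ℂ) + 1 ≠ 0 := by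
      push_cast
      intro h0
      exact hne (by linear_combination -h0)
    have hfac : (k.factorial : ℂ) ≠ 0 := by exact_mod_cast k.factorial_ne_zero
    rw [intervalIntegral.integral_const_mul, h.integral_zpow_mul_log (by exact_mod_cast hne'),
      show (k : ℤ) - n + 1 = k + 1 - n by ring]
    have e : (((k : ℤ) - n : ℤ) : ℂ) + 1 = -((n : ℂ) - 1 - k) := by
      push_cast
      ring
    rw [e]
    field_simp
  · ring

end

/-! ### Closing up pieces of the path -/

/-- Next to any point there are intervals without break points. -/
lemma exists_disjoint_Ioo {P : Set ℝ}
    (hP : ∀ a b : ℝ, (P ∩ Set.Icc a b).Finite) (t : ℝ) :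
    ∃ δ > 0, Disjoint (Set.Ioo (t - δ) t) P ∧ Disjoint (Set.Ioo t (t + δ)) P := by
  have hfin : ((P ∩ Set.Icc (t - 1) (t + 1)) \ {t}).Finite := (hP _ _).sdiff
  have hmem : ((P ∩ Set.Icc (t - 1) (t + 1)) \ {t})ᶜ ∈ 𝓝 t :=
    hfin.isClosed.isOpen_compl.mem_nhds (by simp)
  obtain ⟨δ, hδ, hball⟩ := Metric.mem_nhds_iff.1 hmem
  have key : ∀ x : ℝ, |x - t| < min δ 1 → x ≠ t → x ∉ P := by
    intro x hx hxt hxP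
    have h1 := abs_lt.1 (hx.trans_le (min_le_right _ _))
    refine hball (show x ∈ Metric.ball t δ from ?_)
      ⟨⟨hxP, by linarith [h1.1], by linarith [h1.2]⟩, hxt⟩
    rw [Metric.mem_ball, Real.dist_eq]
    exact hx.trans_le (min_le_left _ _)
  refine ⟨min δ 1, lt_min hδ one_pos, ?_, ?_⟩ <;> rw [Set.disjoint_left] <;> intro x hx
  · refine key x ?_ hx.2.ne
    rw [abs_lt]; constructor <;> linarith [hx.1, hx.2]
  · refine key x ?_ hx.1.ne'
    rw [abs_lt]; constructor <;> linarith [hx.1, hx.2]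

lemma IsPiecewiseC1Path.isCurve {γ : ℝ → ℂ} (hγ : IsPiecewiseC1Path γ) {a b : ℝ} (hab : a ≤ b) :
    IsCurve a b γ (deriv γ) := by
  obtain ⟨hcont, P, hP, hC1⟩ := hγ
  have hpiece : ∀ u v : ℝ, u < v → Disjoint (Set.Ioo u v) P →
      (∀ t ∈ Set.Ioo u v, HasDerivAt γ (deriv γ t) t) ∧
        IntegrableOn (deriv γ) (Set.Ioo u v) := by
    intro u v huv hdisj
    have h1 := hC1 u v huv hdisj
    refine ⟨fun t ht => ?_, ?_⟩
    · exact ((h1.differentiableOn one_ne_zero t (Set.Ioo_subset_Icc_self ht)).differentiableAt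
        (Icc_mem_nhds ht.1 ht.2)).hasDerivAt
    · have h2 := h1.continuousOn_derivWithin (uniqueDiffOn_Icc huv) le_rfl
      refine (h2.integrableOn_Icc.mono_set Set.Ioo_subset_Icc_self).congr_fun (fun t ht => ?_)
        measurableSet_Ioo
      exact derivWithin_of_mem_nhds (Icc_mem_nhds ht.1 ht.2)
  refine ⟨hab, hcont.continuousOn, ⟨P ∩ Set.Icc a b, (hP a b).countable, fun t ht => ?_⟩, ?_⟩
  · obtain ⟨δ, hδ, hl, hr⟩ := exists_disjoint_Ioo hP t
    have htP : t ∉ P := fun h => ht.2 ⟨h, Set.Ioo_subset_Icc_self ht.1⟩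
    refine (hpiece (t - δ) (t + δ) (by linarith) ?_).1 t ⟨by linarith, by linarith⟩
    rw [Set.disjoint_left] at hl hr ⊢
    intro x hx
    rcases lt_trichotomy x t with h | rfl | h
    · exact hl ⟨hx.1, h⟩
    · exact htP
    · exact hr ⟨h, hx.2⟩
  · have hloc : LocallyIntegrable (deriv γ) := by
      intro t
      obtain ⟨δ, hδ, hl, hr⟩ := exists_disjoint_Ioo hP t
      refine ⟨Set.Ioo (t - δ) t ∪ {t} ∪ Set.Ioo t (t + δ), ?_, ?_⟩
      · filter_upwards [Ioo_mem_nhds (show t - δ < t by linarith) (show t < t + δ by linarith)]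
          with x hx
        rcases lt_trichotomy x t with h | h | h
        · exact Or.inl (Or.inl ⟨hx.1, h⟩)
        · exact Or.inl (Or.inr h)
        · exact Or.inr ⟨h, hx.2⟩
      · refine (((hpiece _ _ (by linarith) hl).2.union ?_)).union (hpiece _ _ (by linarith) hr).2
        simp
    exact (hloc.integrableOn_isCompact isCompact_uIcc).intervalIntegrable

lemma norm_log_le {w : ℂ} {m M : ℝ} (hm : 0 < m) (h1 : m ≤ ‖w‖) (h2 : ‖w‖ ≤ M) :
    ‖Complex.log w‖ ≤ |Real.log m| + |Real.log M| + Real.pi := by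
  have h3 : |Real.log ‖w‖| ≤ |Real.log m| + |Real.log M| := by
    have l1 := Real.log_le_log hm h1
    have l2 := Real.log_le_log (hm.trans_le h1) h2
    rw [abs_le]
    constructor <;>
      linarith [neg_abs_le (Real.log m), le_abs_self (Real.log M), abs_nonneg (Real.log m),
        abs_nonneg (Real.log M)]
  calc ‖Complex.log w‖ ≤ |(Complex.log w).re| + |(Complex.log w).im| :=
        Complex.norm_le_abs_re_add_abs_im _
    _ ≤ _ := by
      rw [Complex.log_re, Complex.log_im]
      exact add_le_add h3 (Complex.abs_arg_le_pi w)

lemma log_neg_circleMap {R θ : ℝ} (hR : 0 < R) (h1 : 0 < θ) (h2 : θ < 2 * Real.pi) :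
    Complex.log (-circleMap 0 R θ) = Real.log R + ((θ - Real.pi : ℝ) : ℂ) * Complex.I := by
  have e : -circleMap 0 R θ = R * Complex.exp (((θ - Real.pi : ℝ) : ℂ) * Complex.I) := by
    push_cast
    rw [circleMap_zero, sub_mul, Complex.exp_sub, Complex.exp_pi_mul_I]
    ring
  rw [e, Complex.log_ofReal_mul hR (Complex.exp_ne_zero _), Complex.log_exp]
  · rw [Complex.mul_I_im, Complex.ofReal_re]; linarith
  · rw [Complex.mul_I_im, Complex.ofReal_re]; linarith

lemma log_neg_circleMap_of_neg {R θ : ℝ} (hR : 0 < R) (h1 : -(2 * Real.pi) < θ) (h2 : θ < 0) :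
    Complex.log (-circleMap 0 R θ) = Real.log R + ((θ + Real.pi : ℝ) : ℂ) * Complex.I := by
  rw [← periodic_circleMap 0 R θ, log_neg_circleMap hR (by linarith) (by linarith)]
  congr 3
  ring

lemma circleMap_ne_ofReal {R θ : ℝ} (hR : 0 < R) (h1 : 0 < θ) (h2 : θ < 2 * Real.pi) {x : ℝ}
    (hx : 0 ≤ x) : circleMap 0 R θ ≠ x := by
  intro h
  have hn : x = R := by
    have := congrArg norm h
    rw [norm_circleMap_zero, abs_of_pos hR, Complex.norm_real, Real.norm_of_nonneg hx] at this
    exact this.symm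
  have h3 := congrArg Complex.im (log_neg_circleMap hR h1 h2)
  rw [h, hn, Complex.log_im, ← Complex.ofReal_neg, Complex.arg_ofReal_of_neg (by linarith)] at h3
  simp at h3
  linarith

lemma circleMap_ne_ofReal_of_neg {R θ : ℝ} (hR : 0 < R) (h1 : -(2 * Real.pi) < θ) (h2 : θ < 0)
    {x : ℝ} (hx : 0 ≤ x) : circleMap 0 R θ ≠ x := by
  rw [← periodic_circleMap 0 R θ]
  exact circleMap_ne_ofReal hR (by linarith) (by linarith) hx

/-- A bound for `log (r - z)` on a circle which is uniform in `r`, and integrable along the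
circle. -/
lemma norm_log_sub_circleMap_le {R θ r : ℝ} (hR : 0 < R) (hr : r ∈ Set.Icc 0 (2 * R))
    (hne : ∀ x : ℝ, 0 ≤ x → circleMap 0 R θ ≠ x) :
    ‖Complex.log (r - circleMap 0 R θ)‖ ≤
      |Real.log R| + |Real.log (3 * R)| + Real.pi + |Real.log (Real.sin θ)| := by
  have hup : ‖(r : ℂ) - circleMap 0 R θ‖ ≤ 3 * R := by
    have := norm_sub_le (r : ℂ) (circleMap 0 R θ)
    rw [Complex.norm_real, Real.norm_of_nonneg hr.1, norm_circleMap_zero, abs_of_pos hR] at this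
    linarith [hr.2]
  have hcm : circleMap 0 R θ =
      ((R * Real.cos θ : ℝ) : ℂ) + ((R * Real.sin θ : ℝ) : ℂ) * Complex.I := by
    rw [circleMap_zero, Complex.exp_mul_I]
    push_cast
    ring
  by_cases hs : Real.sin θ = 0
  · have hcos : Real.cos θ < 0 := by
      by_contra! h
      refine hne (R * Real.cos θ) (by positivity) ?_
      rw [hcm, hs]
      simp
    have hcos' : Real.cos θ = -1 := by
      have := Real.sin_sq_add_cos_sq θ
      rw [hs] at this
      nlinarith
    have hlow : R ≤ ‖(r : ℂ) - circleMap 0 R θ‖ := by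
      have : (r : ℂ) - circleMap 0 R θ = ((r + R : ℝ) : ℂ) := by
        rw [hcm, hs, hcos']
        push_cast
        ring
      rw [this, Complex.norm_real, Real.norm_of_nonneg (by linarith [hr.1])]
      linarith [hr.1]
    have := norm_log_le hR hlow hup
    linarith [abs_nonneg (Real.log (Real.sin θ))]
  · have hlow : R * |Real.sin θ| ≤ ‖(r : ℂ) - circleMap 0 R θ‖ := by
      refine le_trans (le_of_eq ?_) (Complex.abs_im_le_norm _)
      rw [hcm]
      simp [-Complex.ofReal_mul, abs_mul, abs_of_pos hR]
    have hpos : 0 < |Real.sin θ| := abs_pos.2 hs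
    have := norm_log_le (mul_pos hR hpos) hlow hup
    rw [Real.log_mul hR.ne' hpos.ne', Real.log_abs] at this
    linarith [abs_add_le (Real.log R) (Real.log (Real.sin θ))]

lemma argAbove_mem {z : ℂ} (hz : ∀ x : ℝ, 0 ≤ x → z ≠ x) :
    argAbove z ∈ Set.Ioo 0 (2 * Real.pi) := by
  have h1 : -z ∈ Complex.slitPlane := by
    simpa using ofReal_sub_mem_slitPlane (r := 0) hz
  have h2 := (Complex.mem_slitPlane_iff_arg.1 h1).1
  have h3 := Complex.arg_le_pi (-z)
  have h4 := Complex.neg_pi_lt_arg (-z)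
  have h5 := lt_of_le_of_ne h3 h2
  rw [argAbove]
  constructor <;> linarith

lemma circleMap_argAbove (z : ℂ) : circleMap 0 ‖z‖ (argAbove z) = z := by
  rw [circleMap_zero, argAbove, Complex.ofReal_add, add_mul, Complex.exp_add,
    Complex.exp_pi_mul_I, ← norm_neg]
  have := Complex.norm_mul_exp_arg_mul_I (-z)
  linear_combination -this

lemma argBelow_eq (z : ℂ) : argBelow z = argAbove z - 2 * Real.pi := by
  rw [argBelow, argAbove]
  ring

lemma circleMap_argBelow (z : ℂ) : circleMap 0 ‖z‖ (argBelow z) = z := by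
  rw [argBelow_eq, (periodic_circleMap 0 ‖z‖).sub_eq, circleMap_argAbove]

lemma argBelow_mem {z : ℂ} (hz : ∀ x : ℝ, 0 ≤ x → z ≠ x) :
    argBelow z ∈ Set.Ioo (-(2 * Real.pi)) 0 := by
  have := argAbove_mem hz
  rw [argBelow_eq]
  constructor <;> linarith [this.1, this.2]

/-- `γ` on `[a, b]`, preceded by `u` on `[0, θ₁]` and followed by `u` on `[θ₂, 0]`, where the
parameter of `u` is shifted so as to make a function on `[a - θ₁, b - θ₂]`. For `u = circleMap 0 R`
this is the closed curve in `closedUpIndex`, with the starting point moved to the positive real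
axis. -/
noncomputable def closeUp (a b θ₁ θ₂ : ℝ) (u γ : ℝ → ℂ) (t : ℝ) : ℂ :=
  if t ≤ b then (if t ≤ a then u (t + (θ₁ - a)) else γ t) else u (t + (θ₂ - b))

section closeUp

variable {a b θ₁ θ₂ : ℝ} {u u' γ γ' : ℝ → ℂ}

lemma closeUp_first (hab : a ≤ b) {t : ℝ} (ht : t ≤ a) :
    closeUp a b θ₁ θ₂ u γ t = u (t + (θ₁ - a)) := by
  rw [closeUp, if_pos (ht.trans hab), if_pos ht]

lemma closeUp_mid {t : ℝ} (ht : a < t) (htb : t ≤ b) : closeUp a b θ₁ θ₂ u γ t = γ t := by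
  rw [closeUp, if_pos htb, if_neg ht.not_ge]

lemma closeUp_last {t : ℝ} (ht : b < t) :
    closeUp a b θ₁ θ₂ u γ t = u (t + (θ₂ - b)) := by
  rw [closeUp, if_neg ht.not_ge]

/-- The integral over the closed-up path is the sum of the integrals over its two parts, in the
form in which `closedUpIndex` has them. -/
lemma integral_closeUp (hab : a ≤ b) (h₁ : 0 ≤ θ₁) (h₂ : θ₂ ≤ 0) (G : ℂ → ℂ)
    (hint : IntervalIntegrable (fun t => G (closeUp a b θ₁ θ₂ u γ t) * closeUp a b θ₁ θ₂ u' γ' t)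
      volume (a - θ₁) (b - θ₂)) :
    ∫ t in (a - θ₁)..(b - θ₂), G (closeUp a b θ₁ θ₂ u γ t) * closeUp a b θ₁ θ₂ u' γ' t =
      (∫ t in a..b, G (γ t) * γ' t) + ∫ θ in θ₂..θ₁, G (u θ) * u' θ := by
  set F := fun t => G (closeUp a b θ₁ θ₂ u γ t) * closeUp a b θ₁ θ₂ u' γ' t with hF
  set U := fun θ => G (u θ) * u' θ with hU
  have hse : a - θ₁ ≤ b - θ₂ := by linarith
  have i1 : IntervalIntegrable F volume (a - θ₁) a := hint.mono_set (by
    rw [Set.uIcc_of_le hse, Set.uIcc_of_le (by linarith)]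
    exact Set.Icc_subset_Icc_right (by linarith))
  have i2 : IntervalIntegrable F volume a b := hint.mono_set (by
    rw [Set.uIcc_of_le hse, Set.uIcc_of_le hab]
    exact Set.Icc_subset_Icc (by linarith) (by linarith))
  have i3 : IntervalIntegrable F volume b (b - θ₂) := hint.mono_set (by
    rw [Set.uIcc_of_le hse, Set.uIcc_of_le (by linarith)]
    exact Set.Icc_subset_Icc_left (by linarith))
  have c1 : ∀ t ∈ Set.uIoc (a - θ₁) a, F t = U (t + (θ₁ - a)) := fun t ht => by
    rw [Set.uIoc_of_le (by linarith)] at ht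
    simp only [hF, hU, closeUp_first hab ht.2]
  have c2 : ∀ t ∈ Set.uIoc a b, F t = G (γ t) * γ' t := fun t ht => by
    rw [Set.uIoc_of_le hab] at ht
    simp only [hF, closeUp_mid ht.1 ht.2]
  have c3 : ∀ t ∈ Set.uIoc b (b - θ₂), F t = U (t + (θ₂ - b)) := fun t ht => by
    rw [Set.uIoc_of_le (by linarith)] at ht
    simp only [hF, hU, closeUp_last ht.1]
  have j1 : IntervalIntegrable U volume 0 θ₁ := by
    have := (i1.congr c1).comp_add_right (-(θ₁ - a))
    simp only [neg_add_cancel_right] at this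
    convert this using 1 <;> ring
  have j3 : IntervalIntegrable U volume θ₂ 0 := by
    have := (i3.congr c3).comp_add_right (-(θ₂ - b))
    simp only [neg_add_cancel_right] at this
    convert this using 1 <;> ring
  rw [← intervalIntegral.integral_add_adjacent_intervals (i1.trans i2) i3,
    ← intervalIntegral.integral_add_adjacent_intervals i1 i2,
    ← intervalIntegral.integral_add_adjacent_intervals j3 j1,
    intervalIntegral.integral_congr_ae (Eventually.of_forall c1),
    intervalIntegral.integral_congr_ae (Eventually.of_forall c2),
    intervalIntegral.integral_congr_ae (Eventually.of_forall c3),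
    intervalIntegral.integral_comp_add_right, intervalIntegral.integral_comp_add_right]
  rw [show a - θ₁ + (θ₁ - a) = 0 by ring, show a + (θ₁ - a) = θ₁ by ring,
    show b + (θ₂ - b) = θ₂ by ring, show b - θ₂ + (θ₂ - b) = 0 by ring]
  ring

end closeUp

/-- The pieces of a path around `[0, ∞)` which occur in the definition of `EncirclesHalfLine`,
closed up by their arcs, are keyhole curves. -/
theorem EncirclesHalfLine.isKeyhole {γ : ℝ → ℂ} {D : Set ℂ} (hγ : EncirclesHalfLine γ D)
    {a b : ℝ} (hab : a ≤ b) (hnorm : ‖γ a‖ = ‖γ b‖)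
    (harc : ∀ θ ∈ Set.Icc (argBelow (γ b)) (argAbove (γ a)), circleMap 0 ‖γ a‖ θ ∈ D)
    (hone : ∀ x : ℝ, 0 ≤ x → x < ‖γ a‖ → closedUpIndex γ a b (x : ℂ) = 1)
    (hzero : ∀ w : ℂ, w ∉ D → closedUpIndex γ a b w = 0) :
    IsKeyhole (a - argAbove (γ a)) (b - argBelow (γ b)) ‖γ a‖
      (closeUp a b (argAbove (γ a)) (argBelow (γ b)) (circleMap 0 ‖γ a‖) γ)
      (closeUp a b (argAbove (γ a)) (argBelow (γ b)) (deriv (circleMap 0 ‖γ a‖)) (deriv γ)) D := by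
  set R := ‖γ a‖ with hRdef
  set θ₁ := argAbove (γ a) with hθ₁
  set θ₂ := argBelow (γ b) with hθ₂
  have hR : 0 < R := norm_pos_iff.2 (by simpa using hγ.avoids a 0 le_rfl)
  have h₁ : θ₁ ∈ Set.Ioo 0 (2 * Real.pi) := argAbove_mem (hγ.avoids a)
  have h₂ : θ₂ ∈ Set.Ioo (-(2 * Real.pi)) 0 := argBelow_mem (hγ.avoids b)
  have hj₁ : circleMap 0 R θ₁ = γ a := circleMap_argAbove (γ a)
  have hj₂ : circleMap 0 R θ₂ = γ b := by rw [hnorm]; exact circleMap_argBelow (γ b)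
  set c := closeUp a b θ₁ θ₂ (circleMap 0 R) γ with hc
  set c' := closeUp a b θ₁ θ₂ (deriv (circleMap 0 R)) (deriv γ) with hc'
  have hsa : a - θ₁ ≤ a := by linarith [h₁.1]
  have hbe : b ≤ b - θ₂ := by linarith [h₂.2]
  have hcurve : IsCurve (a - θ₁) (b - θ₂) c c' := by
    refine ((IsCurve.circleMap_add R (θ₁ - a) hsa).append (hγ.piecewiseC1.isCurve hab) ?_).append
      (IsCurve.circleMap_add R (θ₂ - b) hbe) ?_
    · rw [add_sub_cancel, hj₁]
    · rw [add_sub_cancel, hj₂]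
      split_ifs with hba
      · rw [le_antisymm hba hab, add_sub_cancel, hj₁]
      · rfl
  -- the three parts of the curve, without the end points
  have hcases : ∀ t ∈ Set.Ioo (a - θ₁) (b - θ₂),
      (t ≤ a ∧ t + (θ₁ - a) ∈ Set.Ioc 0 θ₁) ∨ t ∈ Set.Ioc a b ∨
        (b < t ∧ t + (θ₂ - b) ∈ Set.Ioo θ₂ 0) := by
    intro t ht
    rcases le_or_gt t a with h | h
    · exact Or.inl ⟨h, by linarith [ht.1], by linarith⟩
    rcases le_or_gt t b with h' | h'
    · exact Or.inr (Or.inl ⟨h, h'⟩)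
    · exact Or.inr (Or.inr ⟨h', by linarith, by linarith [ht.2]⟩)
  have hstart : c (a - θ₁) = R := by
    rw [hc, closeUp_first hab hsa, show a - θ₁ + (θ₁ - a) = 0 by ring]
    simp [circleMap]
  have hend : c (b - θ₂) = R := by
    rw [hc, closeUp_last (by linarith [h₂.2]), show b - θ₂ + (θ₂ - b) = 0 by ring]
    simp [circleMap]
  have havoids : ∀ t ∈ Set.Ioo (a - θ₁) (b - θ₂), ∀ x : ℝ, 0 ≤ x → c t ≠ x := by
    intro t ht x hx
    rcases hcases t ht with ⟨h, h'⟩ | h | ⟨h, h'⟩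
    · rw [hc, closeUp_first hab h]
      exact circleMap_ne_ofReal hR h'.1 (h'.2.trans_lt h₁.2) hx
    · rw [hc, closeUp_mid h.1 h.2]
      exact hγ.avoids t x hx
    · rw [hc, closeUp_last h]
      exact circleMap_ne_ofReal_of_neg hR (h₂.1.trans h'.1) h'.2 hx
  have hmem : ∀ t ∈ Set.Icc (a - θ₁) (b - θ₂), c t ∈ D := by
    intro t ht
    rcases le_or_gt t a with h | h
    · rw [hc, closeUp_first hab h]
      exact harc _ ⟨by linarith [ht.1, h₂.2], by linarith⟩
    rcases le_or_gt t b with h' | h'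
    · rw [hc, closeUp_mid h h']
      exact hγ.mem_domain t
    · rw [hc, closeUp_last h']
      exact harc _ ⟨by linarith, by linarith [ht.2, h₁.1]⟩
  have hindex : ∀ w : ℂ, w ∉ c '' Set.Icc (a - θ₁) (b - θ₂) →
      windingIntegral (a - θ₁) (b - θ₂) c c' w =
        2 * Real.pi * Complex.I * closedUpIndex γ a b w := by
    intro w hw
    have hi := hcurve.intervalIntegrable_mul
      (hcurve.continuousOn_div_sub (continuousOn_const (c := (1 : ℂ))) hw)
    rw [windingIntegral, hc, hc', integral_closeUp hab h₁.1.le h₂.2.le (fun z => 1 / (z - w)) hi,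
      closedUpIndex, mul_inv_cancel_left₀ Complex.two_pi_I_ne_zero]
    simp only [one_div_mul_eq_div]
    rfl
  refine ⟨hcurve, hR, hstart, hend, havoids, hmem, fun x hx hxR => ?_, fun w hw => ?_, ?_, ?_⟩
  · rw [hindex, hone x hx hxR, mul_one]
    rintro ⟨t, ht, htx⟩
    rcases ht.1.eq_or_lt with rfl | h1
    · rw [hstart] at htx
      exact hxR.ne' (by exact_mod_cast htx)
    rcases ht.2.eq_or_lt with rfl | h2
    · rw [hend] at htx
      exact hxR.ne' (by exact_mod_cast htx)
    exact havoids t ⟨h1, h2⟩ x hx htx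
  · rw [hindex, hzero w hw, mul_zero]
    rintro ⟨t, ht, rfl⟩
    exact hw (hmem t ht)
  · -- on `γ` the logarithms are bounded, on the arcs they are dominated by `log ∘ sin`
    have hcompact : IsCompact (Set.Icc 0 (2 * R) ×ˢ Set.Icc a b) := isCompact_Icc.prod isCompact_Icc
    have hcontn : ContinuousOn (fun p : ℝ × ℝ => ‖(p.1 : ℂ) - γ p.2‖)
        (Set.Icc 0 (2 * R) ×ˢ Set.Icc a b) :=
      ((Complex.continuous_ofReal.comp continuous_fst).sub
        (hγ.piecewiseC1.1.comp continuous_snd)).norm.continuousOn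
    obtain ⟨δ, hδ, hlow⟩ := hcompact.exists_forall_le' hcontn (a := 0) fun p hp =>
      norm_pos_iff.2 (sub_ne_zero.2 (hγ.avoids p.2 p.1 hp.1.1).symm)
    obtain ⟨M, hup⟩ := (hcompact.image_of_continuousOn hcontn).isBounded.exists_norm_le
    set K := |Real.log R| + |Real.log (3 * R)| + Real.pi + (|Real.log δ| + |Real.log M|) with hK
    have hsin : ∀ k : ℝ, IntervalIntegrable (fun t => R * |Real.log (Real.sin (t + k))|) volume
        (a - θ₁) (b - θ₂) := fun k => by
      have h0 : IntervalIntegrable (Real.log ∘ Real.sin) volume (a - θ₁ + k) (b - θ₂ + k) :=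
        intervalIntegrable_log_sin
      have := (h0.comp_add_right k).abs.const_mul R
      simpa using this
    refine ⟨fun t => K * ‖c' t‖ + R * |Real.log (Real.sin (t + (θ₁ - a)))| +
      R * |Real.log (Real.sin (t + (θ₂ - b)))|,
      ((hcurve.integrable.norm.const_mul K).add (hsin _)).add (hsin _), fun r hr t ht => ?_⟩
    have e1 : 0 ≤ R * |Real.log (Real.sin (t + (θ₁ - a)))| := by positivity
    have e2 : 0 ≤ R * |Real.log (Real.sin (t + (θ₂ - b)))| := by positivity
    have hKR : 0 ≤ |Real.log δ| + |Real.log M| := by positivity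
    have hnd : ∀ θ, ‖deriv (circleMap 0 R) θ‖ = R := fun θ => by
      simp [deriv_circleMap, abs_of_pos hR]
    have hcirc : ∀ θ, (∀ x : ℝ, 0 ≤ x → circleMap 0 R θ ≠ x) →
        ‖Complex.log (r - circleMap 0 R θ)‖ * R ≤ K * R + R * |Real.log (Real.sin θ)| := by
      intro θ hθ
      have := norm_log_sub_circleMap_le hR hr hθ
      nlinarith
    rcases hcases t ht with ⟨h, h'⟩ | h | ⟨h, h'⟩
    · have hav := havoids t ht
      simp only [hc, hc', closeUp_first hab h, hnd] at hav ⊢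
      linarith [hcirc _ hav]
    · simp only [hc, hc', closeUp_mid h.1 h.2]
      have hp : (r, t) ∈ Set.Icc 0 (2 * R) ×ˢ Set.Icc a b := ⟨hr, h.1.le, h.2⟩
      have hu := hup _ ⟨(r, t), hp, rfl⟩
      rw [norm_norm] at hu
      have h5 : ‖Complex.log (r - γ t)‖ ≤ K := by
        refine (norm_log_le hδ (hlow (r, t) hp) hu).trans ?_
        linarith [abs_nonneg (Real.log R), abs_nonneg (Real.log (3 * R))]
      have := mul_le_mul_of_nonneg_right h5 (norm_nonneg (deriv γ t))
      linarith
    · have hav := havoids t ht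
      simp only [hc, hc', closeUp_last h, hnd] at hav ⊢
      linarith [hcirc _ hav]
  · have hla : Complex.log (-γ a) = Real.log R + ((θ₁ - Real.pi : ℝ) : ℂ) * Complex.I := by
      rw [← hj₁, log_neg_circleMap hR h₁.1 h₁.2]
    have hlb : Complex.log (-γ b) = Real.log R + ((θ₂ + Real.pi : ℝ) : ℂ) * Complex.I := by
      rw [← hj₂, log_neg_circleMap_of_neg hR h₂.1 h₂.2]
    refine ⟨fun t => if t ≤ b then (if t ≤ a then
        (Real.log R : ℂ) + ((t + (θ₁ - a) - Real.pi : ℝ) : ℂ) * Complex.I else Complex.log (-γ t))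
      else Real.log R + ((t + (θ₂ - b) + Real.pi : ℝ) : ℂ) * Complex.I, ?_, ?_, ?_, ?_⟩
    · refine continuousOn_ite_le (hsa.trans hab) hbe ?_ (by fun_prop) ?_
      · refine continuousOn_ite_le hsa hab (by fun_prop) ?_ ?_
        · refine hγ.piecewiseC1.1.neg.continuousOn.clog fun t _ => ?_
          simpa using ofReal_sub_mem_slitPlane (r := 0) (hγ.avoids t)
        · rw [hla, add_sub_cancel]
      · split_ifs with hba
        · have hab' : b = a := le_antisymm hba hab
          rw [← hab'] at hla
          rw [show b + (θ₁ - a) = θ₁ by rw [hab']; ring, add_sub_cancel, ← hla, ← hlb]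
        · rw [hlb, add_sub_cancel]
    · intro t ht
      beta_reduce
      rcases hcases t ht with ⟨h, h'⟩ | h | ⟨h, h'⟩
      · rw [if_pos (h.trans hab), if_pos h, hc, closeUp_first hab h,
          log_neg_circleMap hR h'.1 (h'.2.trans_lt h₁.2)]
      · rw [if_pos h.2, if_neg h.1.not_ge, hc, closeUp_mid h.1 h.2]
      · rw [if_neg h.not_ge, hc, closeUp_last h,
          log_neg_circleMap_of_neg hR (h₂.1.trans h'.1) h'.2]
    · beta_reduce
      rw [if_pos (hsa.trans hab), if_pos hsa, show a - θ₁ + (θ₁ - a) - Real.pi = -Real.pi by ring]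
      push_cast
      ring
    · beta_reduce
      rw [if_neg (show ¬b - θ₂ ≤ b by linarith [h₂.2]),
        show b - θ₂ + (θ₂ - b) + Real.pi = Real.pi by ring]

/-! ### Passage to the limit -/

section

variable {n : ℕ} {α : ℝ} {D : Set ℂ} {f : ℂ → ℂ} {γ : ℝ → ℂ}

/-- The logarithm costs an arbitrarily small power. -/
lemma exists_norm_integrand_le
    (hgrowth : f =O[cocompact ℂ ⊓ 𝓟 D] fun z : ℂ => ‖z‖ ^ ((n : ℝ) - 1 - α))
    {β : ℝ} (hβ : β < α) :
    ∃ C X : ℝ, 0 < C ∧ 1 ≤ X ∧ ∀ z ∈ D, X ≤ ‖z‖ →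
      ‖z ^ (-(n : ℤ)) * f z * Complex.log (-z)‖ ≤ C * ‖z‖ ^ (-(1 + β)) := by
  obtain ⟨C, X, hC, hX, hle⟩ := exists_norm_zpow_neg_mul_le hgrowth
  have hδ : 0 < α - β := sub_pos.2 hβ
  have hK : 0 < 2 * (1 / (α - β)) + Real.pi := by positivity
  refine ⟨C * (2 * (1 / (α - β)) + Real.pi), X, by positivity, hX, fun z hz hzX => ?_⟩
  have hz1 : 1 ≤ ‖z‖ := hX.trans hzX
  have hz0 : 0 < ‖z‖ := one_pos.trans_le hz1
  have hlog : ‖Complex.log (-z)‖ ≤ (2 * (1 / (α - β)) + Real.pi) * ‖z‖ ^ (α - β) := by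
    have h1 := norm_log_le hz0 (norm_neg z).ge (norm_neg z).le
    rw [abs_of_nonneg (Real.log_nonneg hz1)] at h1
    have h2 := Real.log_le_rpow_div hz0.le hδ
    have h3 : Real.pi * 1 ≤ Real.pi * ‖z‖ ^ (α - β) := by
      gcongr
      exact Real.one_le_rpow hz1 hδ.le
    calc _ ≤ _ := h1
      _ ≤ ‖z‖ ^ (α - β) / (α - β) + ‖z‖ ^ (α - β) / (α - β) + Real.pi * ‖z‖ ^ (α - β) := by
        linarith
      _ = _ := by ring
  calc ‖z ^ (-(n : ℤ)) * f z * Complex.log (-z)‖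
      ≤ (C * ‖z‖ ^ (-1 - α)) * ((2 * (1 / (α - β)) + Real.pi) * ‖z‖ ^ (α - β)) := by
        rw [norm_mul]
        exact mul_le_mul (hle z hz hzX) hlog (norm_nonneg _) (by positivity)
    _ = C * (2 * (1 / (α - β)) + Real.pi) * (‖z‖ ^ (-1 - α) * ‖z‖ ^ (α - β)) := by ring
    _ = _ := by
      rw [← Real.rpow_add hz0]
      congr 2
      ring

lemma norm_integral_arc_le {G : ℂ → ℂ} {B R θ₁ θ₂ : ℝ} (hR : 0 < R) (h : θ₂ ≤ θ₁)
    (hlen : θ₁ - θ₂ ≤ 4 * Real.pi)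
    (hB : ∀ θ ∈ Set.Icc θ₂ θ₁, ‖G (circleMap 0 R θ)‖ ≤ B) :
    ‖∫ θ in θ₂..θ₁, G (circleMap 0 R θ) * deriv (circleMap 0 R) θ‖ ≤ B * R * (4 * Real.pi) := by
  have hB0 : 0 ≤ B := (norm_nonneg _).trans (hB θ₂ ⟨le_rfl, h⟩)
  refine (intervalIntegral.norm_integral_le_of_norm_le_const (C := B * R) fun θ hθ => ?_).trans ?_
  · rw [Set.uIoc_of_le h] at hθ
    have h1 : ‖deriv (circleMap 0 R) θ‖ = R := by simp [deriv_circleMap, abs_of_pos hR]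
    rw [norm_mul, h1]
    exact mul_le_mul_of_nonneg_right (hB θ (Set.Ioc_subset_Icc_self hθ)) hR.le
  · rw [abs_of_nonneg (sub_nonneg.2 h)]
    gcongr

/-- Along the radii for which pieces of the path can be closed up, the contour integrals over the
closed curves tend to the finite part, and the contributions of the arcs tend to zero. -/
lemma eq_of_hasContourIntegral (hn : 1 ≤ n) (hα : 0 < α) (hD : IsOpen D)
    (hDR : ∀ x : ℝ, 0 ≤ x → (x : ℂ) ∈ D) (hf : DifferentiableOn ℂ f D)
    (hgrowth : f =O[cocompact ℂ ⊓ 𝓟 D] fun z : ℂ => ‖z‖ ^ ((n : ℝ) - 1 - α))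
    (hγ : EncirclesHalfLine γ D) {I : ℂ} (hI : Tendsto (fpPrimitive n f) atTop (𝓝 I)) {J : ℂ}
    (hJ : HasContourIntegral γ (fun z => z ^ (-(n : ℤ)) * f z * Complex.log (-z)) J) :
    I = (2 * Real.pi * Complex.I)⁻¹ * J := by
  obtain ⟨C, X, hC, hX, hle⟩ := exists_norm_integrand_le hgrowth (half_lt_self hα)
  set G : ℂ → ℂ := fun z => z ^ (-(n : ℤ)) * f z * Complex.log (-z) with hG
  choose a b ha hb hab hnorm harc hone hzero using fun N : ℕ => hγ.winds N
  have hta : Tendsto a atTop atBot :=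
    tendsto_atBot_mono ha (tendsto_neg_atTop_atBot.comp tendsto_natCast_atTop_atTop)
  have htb : Tendsto b atTop atTop := tendsto_atTop_mono hb tendsto_natCast_atTop_atTop
  have hR : Tendsto (fun N => ‖γ (a N)‖) atTop atTop :=
    tendsto_norm_cocompact_atTop.comp
      (hγ.tendsto_infinity.comp (hta.mono_right atBot_le_cocompact))
  have h1 : Tendsto (fun N => ∫ t in a N..b N, G (γ t) * deriv γ t) atTop (𝓝 J) :=
    hJ.comp (hta.prodMk htb)
  have h2 : Tendsto (fun N => 2 * Real.pi * Complex.I * fpPrimitive n f ‖γ (a N)‖) atTop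
      (𝓝 (2 * Real.pi * Complex.I * I)) := (hI.comp hR).const_mul _
  have h3 : Tendsto (fun N => 2 * Real.pi * Complex.I * fpPrimitive n f ‖γ (a N)‖ -
      ∫ t in a N..b N, G (γ t) * deriv γ t) atTop (𝓝 0) := by
    have hlim : Tendsto (fun N => C * (4 * Real.pi) * ‖γ (a N)‖ ^ (-(α / 2))) atTop (𝓝 0) := by
      simpa using ((tendsto_rpow_neg_atTop (half_pos hα)).comp hR).const_mul (C * (4 * Real.pi))
    refine squeeze_zero_norm' ?_ hlim
    filter_upwards [hR.eventually_ge_atTop X] with N hN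
    have hpos : 0 < ‖γ (a N)‖ := one_pos.trans_le (hX.trans hN)
    have m1 := argAbove_mem (hγ.avoids (a N))
    have m2 := argBelow_mem (hγ.avoids (b N))
    obtain ⟨hint, heq⟩ := (hγ.isKeyhole (hab N).le (hnorm N) (harc N) (hone N)
      (hzero N)).integral_eq_fpPrimitive hn hD hDR hf
    rw [← heq, integral_closeUp (hab N).le m1.1.le m2.2.le G hint, add_sub_cancel_left]
    refine (norm_integral_arc_le (B := C * ‖γ (a N)‖ ^ (-(1 + α / 2))) hpos
      (m2.2.le.trans m1.1.le) (by linarith [m1.2, m2.1]) fun θ hθ => ?_).trans (le_of_eq ?_)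
    · have hn : ‖circleMap 0 ‖γ (a N)‖ θ‖ = ‖γ (a N)‖ := by
        rw [norm_circleMap_zero, abs_of_pos hpos]
      have := hle _ (harc N θ hθ) (by rwa [hn])
      rwa [hn] at this
    · have hp : ‖γ (a N)‖ ^ (-(α / 2)) = ‖γ (a N)‖ ^ (-(1 + α / 2)) * ‖γ (a N)‖ := by
        rw [← Real.rpow_add_one hpos.ne']
        congr 1
        ring
      rw [hp]
      ring
  have h4 := tendsto_nhds_unique h3 (h2.sub h1)
  have h5 := sub_eq_zero.1 h4.symm
  rw [← h5, inv_mul_cancel_left₀ Complex.two_pi_I_ne_zero]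

lemma rpow_le_two_rpow_mul {r : ℝ} (hr : 1 ≤ r) (p : ℝ) : r ^ p ≤ 2 ^ |p| * (1 + r) ^ p := by
  have hr0 : 0 < r := one_pos.trans_le hr
  rcases le_total 0 p with hp | hp
  · have h1 : r ^ p ≤ (1 + r) ^ p := Real.rpow_le_rpow hr0.le (by linarith) hp
    have h2 : (1 : ℝ) ≤ 2 ^ |p| := Real.one_le_rpow one_le_two (abs_nonneg p)
    exact h1.trans (le_mul_of_one_le_left (by positivity) h2)
  · have h1 : (2 * r) ^ p ≤ (1 + r) ^ p :=
      Real.rpow_le_rpow_of_nonpos (by linarith) (by linarith) hp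
    calc r ^ p = 2 ^ |p| * (2 * r) ^ p := by
          rw [abs_of_nonpos hp, Real.mul_rpow two_pos.le hr0.le, ← mul_assoc,
            ← Real.rpow_add two_pos, neg_add_cancel, Real.rpow_zero, one_mul]
      _ ≤ _ := by gcongr

/-- The contour integral converges absolutely if the path satisfies the length condition for some
`β < α`. -/
lemma exists_hasContourIntegral (hf : ContinuousOn f D)
    (hgrowth : f =O[cocompact ℂ ⊓ 𝓟 D] fun z : ℂ => ‖z‖ ^ ((n : ℝ) - 1 - α))
    (hγ : EncirclesHalfLine γ D) {β : ℝ} (hβ : β < α)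
    (hint : Integrable (fun t : ℝ => ‖deriv γ t‖ * (1 + ‖γ t‖) ^ (-(1 + β)))) :
    ∃ J : ℂ, HasContourIntegral γ (fun z => z ^ (-(n : ℤ)) * f z * Complex.log (-z)) J := by
  obtain ⟨C, X, hC, hX, hle⟩ := exists_norm_integrand_le hgrowth hβ
  set G : ℂ → ℂ := fun z => z ^ (-(n : ℤ)) * f z * Complex.log (-z) with hG
  have hγc : Continuous γ := hγ.piecewiseC1.1
  have hGc : Continuous (fun t => G (γ t)) := by
    refine ((hγc.zpow₀ _ fun t => Or.inl ?_).mul (hf.comp_continuous hγc hγ.mem_domain)).mul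
      (hγc.neg.clog fun t => ?_)
    · simpa using hγ.avoids t 0 le_rfl
    · simpa using ofReal_sub_mem_slitPlane (r := 0) (hγ.avoids t)
  have hloc : LocallyIntegrable (fun t => G (γ t) * deriv γ t) := fun t =>
    ⟨Set.Icc (t - 1) (t + 1), Icc_mem_nhds (by linarith) (by linarith),
      (intervalIntegrable_iff_integrableOn_Icc_of_le (by linarith)).1
        ((hγ.piecewiseC1.isCurve (by linarith)).intervalIntegrable_mul hGc.continuousOn)⟩
  have hbig : (fun t => G (γ t) * deriv γ t) =O[cocompact ℝ]
      fun t : ℝ => ‖deriv γ t‖ * (1 + ‖γ t‖) ^ (-(1 + β)) := by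
    refine IsBigO.of_bound (C * 2 ^ |-(1 + β)|) ?_
    filter_upwards [(tendsto_norm_cocompact_atTop.comp hγ.tendsto_infinity).eventually_ge_atTop X]
      with t ht
    have h1 := hle (γ t) (hγ.mem_domain t) ht
    have h2 := rpow_le_two_rpow_mul (hX.trans ht) (-(1 + β))
    simp only [Function.comp_apply] at h2
    rw [norm_mul, Real.norm_of_nonneg (by positivity)]
    calc ‖G (γ t)‖ * ‖deriv γ t‖
        ≤ C * (2 ^ |-(1 + β)| * (1 + ‖γ t‖) ^ (-(1 + β))) * ‖deriv γ t‖ := by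
          gcongr
          exact h1.trans (by gcongr)
      _ = _ := by ring
  have hI := hloc.integrable_of_isBigO_cocompact hbig (hint.integrableAtFilter _)
  exact ⟨_, intervalIntegral_tendsto_integral hI tendsto_fst tendsto_snd⟩

end

theorem theorem1 (n : ℕ) (hn : 1 ≤ n) (α : ℝ) (hα : 0 < α)
    (D : Set ℂ) (hD : IsOpen D) (hDc : IsConnected D)
    (hD0 : ∀ x : ℝ, 0 ≤ x → (x : ℂ) ∈ D)
    (f : ℂ → ℂ) (hf : AnalyticOnNhd ℂ f D)
    (hgrowth : f =O[cocompact ℂ ⊓ 𝓟 D] fun z : ℂ => ‖z‖ ^ ((n : ℝ) - 1 - α))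
    (γ : ℝ → ℂ) (hγ : EncirclesHalfLine γ D) :
    ∃ I : ℂ, IsFinitePartIntegral n f I ∧
      (∀ J : ℂ, HasContourIntegral γ (fun z => z ^ (-(n : ℤ)) * f z * Complex.log (-z)) J →
        I = (2 * Real.pi * Complex.I)⁻¹ * J) ∧
      (∀ β : ℝ, β < α →
        Integrable (fun t : ℝ => ‖deriv γ t‖ * (1 + ‖γ t‖) ^ (-(1 + β))) →
        ∃ J : ℂ, HasContourIntegral γ (fun z => z ^ (-(n : ℤ)) * f z * Complex.log (-z)) J ∧
          I = (2 * Real.pi * Complex.I)⁻¹ * J) := by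
  have hfd : DifferentiableOn ℂ f D := hf.differentiableOn
  obtain ⟨I, hI, hlim⟩ := exists_isFinitePartIntegral hn hα hD hD0 hfd hgrowth
  refine ⟨I, hI, fun J hJ => eq_of_hasContourIntegral hn hα hD hD0 hfd hgrowth hγ hlim hJ,
    fun β hβ hint => ?_⟩
  obtain ⟨J, hJ⟩ := exists_hasContourIntegral hfd.continuousOn hgrowth hγ hβ hint
  exact ⟨J, hJ, eq_of_hasContourIntegral hn hα hD hD0 hfd hgrowth hγ hlim hJ⟩
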